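/- Let $X$ be a complex Banach space and let $\mathrm{Cos}:\mathbb{R}\to\mathcal{L}(X)$ be a bounded cosine function, i.e. a strongly continuous map with $\mathrm{Cos}(0)=I$, $\mathrm{Cos}(t+s)+\mathrm{Cos}(t-s)=2\,\mathrm{Cos}(t)\mathrm{Cos}(s)$ for all $s,t\in\mathbb{R}$, and $\sup_{t}\|\mathrm{Cos}(t)\|<\infty$. Let $-A$ be its generator, i.e. the operator with $\lambda(\lambda^2+A)^{-1}x=\int_0^\infty e^{-\lambda t}\mathrm{Cos}(t)x\,dt$ for all $\lambda>0$, $x\in X$. For a complex Borel measure $\mu$ on $\mathbb{R}$ put $(\mathcal{C}\mu)(t)=\int_{\mathbb{R}}\cos(st)\,\mu(ds)$ for $t\ge 0$, let $\mathcal{E}=\{\mathcal{C}\mu\}$ be the set of all these functions on $[0,\infty)$, and put $\Phi(\mathcal{C}\mu)x=\int_{\mathbb{R}}\mathrm{Cos}(s)x\,\mu(ds)$ for $x \in X$. Extend $\Phi$ to those $f:[0,\infty)\to\mathbb{C}$ for which there is $e\in\mathcal{E}$ with $ef\in\mathcal{E}$ and $\Phi(e)$ injective, by $\Phi(f)=\Phi(e)^{-1}\Phi(ef)$,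 a possibly unbounded operator with its natural domain $\{x : \Phi(ef)x\in\operatorname{ran}\Phi(e)\}$. Let $B=\Phi(t)$ be the operator obtained from the function $t\mapsto t$ on $[0,\infty)$, and write $f(B)=\Phi(f)$. For $s\in\mathbb{R}$ let $\mathrm{Sin}(s)x=\int_0^s\mathrm{Cos}(r)x\,dr$ and $S(s)=[\operatorname{sgn}(t)\sin(st)](B)$. Then for all $s\in\mathbb{R}$ one has $S(s)=B\,\mathrm{Sin}(s)$ (with equality of domains), and for every $x\in\mathcal{D}(A)$ one has $x\in\mathcal{D}(S(s))$ and $$S(s)x=\frac1\pi\,\mathrm{PV}\!\!\int_{\mathbb{R}}\frac{\mathrm{Cos}(s-r)x}{r}\,dr:=\frac1\pi\lim_{a\searrow0,\ b\nearrow\infty}\int_{a\le|r|\le b}\frac{\mathrm{Cos}(s-r)x}{r}\,dr ,$$ where the limit exists in the norm of $X$, jointly in $(a,b)$. If moreover $X$ is a UMD space, in the sense that $t\mapsto -i\operatorname{sgn}t$ is a bounded $L^2(\mathbb{R};X)$-Fourier multiplier (that is, $\|\mathcal{F}^{-1}(-i\operatorname{sgn}(\cdot)\hat f)\|_{L^2(\mathbb{R};X)}\le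 c\,\|f\|_{L^2(\mathbb{R};X)}$ for all $X$-valued Schwartz functions $f$, with a constant $c$ independent of $f$), then every $S(s)$ is a bounded operator defined on all of $X$, $\sup_{s\in\mathbb{R}}\|S(s)\|<\infty$, and the representation above holds for all $s\in\mathbb{R}$ and all $x\in X$. -/

import Mathlib

open MeasureTheory Filter Topology
open scoped NNReal ENNReal FourierTransform SchwartzMap

noncomputable section

namespace CosineCalculus

/-- The integral `∫ f dμ` of a (bounded continuous) vector-valued function against a complex
measure, by the Jordan decompositions of the real and imaginary parts of `μ`. -/
def cintegral {E : Type*} [NormedAddCommGroup E] [NormedSpace ℂ E]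
    (μ : ComplexMeasure ℝ) (f : ℝ → E) : E :=
  ((∫ s, f s ∂(ComplexMeasure.re μ).toJordanDecomposition.posPart)
      - ∫ s, f s ∂(ComplexMeasure.re μ).toJordanDecomposition.negPart)
    + Complex.I • ((∫ s, f s ∂(ComplexMeasure.im μ).toJordanDecomposition.posPart)
      - ∫ s, f s ∂(ComplexMeasure.im μ).toJordanDecomposition.negPart)

/-- The cosine transform `(𝒞μ)(t) = ∫ cos(st) μ(ds)`, as a function on `[0, ∞)`. -/
def cosTransform (μ : ComplexMeasure ℝ) (t : ℝ≥0) : ℂ :=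
  cintegral μ (fun s : ℝ => ((Real.cos (s * t) : ℝ) : ℂ))

/-- The set `ℰ(ℝ₊)` of all cosine transforms of complex Borel measures on `ℝ`. -/
def cosAlgebra : Set (ℝ≥0 → ℂ) := Set.range cosTransform

/-- `HasPrincipalValue f l`: the integrals of `f` over `{a ≤ |r| ≤ b}` converge to `l`
as `a ↘ 0` and `b ↗ ∞` (jointly). -/
def HasPrincipalValue {E : Type*} [NormedAddCommGroup E] [NormedSpace ℝ E]
    (f : ℝ → E) (l : E) : Prop :=
  Tendsto (fun p : ℝ × ℝ => ∫ r in {r : ℝ | p.1 ≤ |r| ∧ |r| ≤ p.2}, f r)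
    (𝓝[>] (0 : ℝ) ×ˢ atTop) (𝓝 l)

/-- `m ∈ L^∞(ℝ)` is a bounded `L^p(ℝ; X)`-Fourier multiplier: `‖ℱ⁻¹(m f̂)‖_p ≤ c ‖f‖_p` for all
Schwartz functions `f`. Here `f̂(t) = ∫ e^{-ist} f(s) ds`; in terms of Mathlib's Fourier transform
(kernel `e^{-2πisξ}`) the function `ℱ⁻¹(m f̂)` is the one displayed below. -/
def IsFourierMultiplier (X : Type*) [NormedAddCommGroup X] [NormedSpace ℂ X]
    (p : ℝ≥0∞) (m : ℝ → ℂ) : Prop :=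
  MemLp m ∞ ∧ ∃ c : ℝ≥0, ∀ f : 𝓢(ℝ, X),
    eLpNorm (𝓕⁻ (fun ξ : ℝ => m (2 * Real.pi * ξ) • 𝓕 (f : ℝ → X) ξ)) p
      ≤ c * eLpNorm (f : ℝ → X) p

/-- UMD spaces, through the boundedness of the Hilbert transform on `L²(ℝ; X)`:
`-i sgn t` is a bounded `L²(ℝ; X)`-Fourier multiplier. -/
def IsUMD (X : Type*) [NormedAddCommGroup X] [NormedSpace ℂ X] : Prop :=
  IsFourierMultiplier X 2 (fun t : ℝ => -Complex.I * ((Real.sign t : ℝ) : ℂ))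

end CosineCalculus

/-- A cosine function on `X`: a strongly continuous `Cos : ℝ → ℒ(X)` with `Cos 0 = I` and
`Cos (t + s) + Cos (t - s) = 2 Cos t Cos s`. -/
structure CosineFunction (X : Type*) [NormedAddCommGroup X] [NormedSpace ℂ X] where
  toFun : ℝ → X →L[ℂ] X
  map_zero : toFun 0 = ContinuousLinearMap.id ℂ X
  map_add_add_map_sub : ∀ t s : ℝ, ∀ x : X,
    toFun (t + s) x + toFun (t - s) x = (2 : ℂ) • toFun t (toFun s x)
  strongly_continuous : ∀ x : X, Continuous (fun t => toFun t x)

namespace CosineFunction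

open CosineCalculus

variable {X : Type*} [NormedAddCommGroup X] [NormedSpace ℂ X]

instance : CoeFun (CosineFunction X) (fun _ => ℝ → X →L[ℂ] X) := ⟨CosineFunction.toFun⟩

/-- `sup_t ‖Cos t‖ < ∞`. -/
def IsBounded (Cos : CosineFunction X) : Prop := ∃ M : ℝ, ∀ t : ℝ, ‖Cos t‖ ≤ M

/-- The exponential growth bound `θ(Cos)`. -/
def growthBound (Cos : CosineFunction X) : ℝ :=
  sInf {ω : ℝ | 0 ≤ ω ∧ ∃ M : ℝ, 1 ≤ M ∧ ∀ t : ℝ, ‖Cos t‖ ≤ M * Real.exp (ω * |t|)}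

/-- `R` is the (bounded, everywhere defined) inverse of `z - G`. -/
def IsResolventAt (G : X →ₗ.[ℂ] X) (z : ℂ) (R : X →L[ℂ] X) : Prop :=
  (∀ x : X, ∃ h : R x ∈ G.domain, z • R x - G ⟨R x, h⟩ = x) ∧
    ∀ x : G.domain, R (z • (x : X) - G x) = x

/-- `G` is the generator of `Cos`: for all `l > θ(Cos)` the resolvent `R(l², G)` exists and
`l R(l², G) x = ∫₀^∞ e^{-lt} Cos(t) x dt`. -/
def IsGenerator (Cos : CosineFunction X) (G : X →ₗ.[ℂ] X) : Prop :=
  ∀ l : ℝ, Cos.growthBound < l → ∃ R : X →L[ℂ] X, IsResolventAt G ((l : ℂ) ^ 2) R ∧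
    ∀ x : X, (l : ℂ) • R x = ∫ t in Set.Ioi (0 : ℝ), ((Real.exp (-l * t) : ℝ) : ℂ) • Cos t x

/-- The associated sine function `Sin(s) x = ∫₀^s Cos(r) x dr`. -/
def Sin (Cos : CosineFunction X) (s : ℝ) (x : X) : X := ∫ r in (0 : ℝ)..s, Cos r x

theorem integrable_orbit (Cos : CosineFunction X) (hCos : Cos.IsBounded)
    (ν : Measure ℝ) [IsFiniteMeasure ν] (x : X) : Integrable (fun s => Cos s x) ν := by
  obtain ⟨M, hM⟩ := hCos
  refine Integrable.of_bound (Cos.strongly_continuous x).aestronglyMeasurable (M * ‖x‖)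
    (Eventually.of_forall fun s => ?_)
  exact (Cos s).le_of_opNorm_le (hM s) x

/-- The Phillips calculus `T_μ x = ∫ Cos(s) x μ(ds)` of a bounded cosine function. -/
def phillips (Cos : CosineFunction X) (hCos : Cos.IsBounded) (μ : ComplexMeasure ℝ) :
    X →ₗ[ℂ] X where
  toFun x := cintegral μ (fun s => Cos s x)
  map_add' x y := by
    simp only [cintegral, map_add]
    rw [integral_add, integral_add, integral_add, integral_add]
    · module
    all_goals exact Cos.integrable_orbit hCos _ _
  map_smul' c x := by
    simp only [cintegral, map_smul, RingHom.id_apply, integral_smul]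
    module

open Classical in
/-- The primary calculus `Φ(𝒞μ) = T_μ` for functions in `ℰ(ℝ₊)` (junk value `0` elsewhere). -/
def primary (Cos : CosineFunction X) (hCos : Cos.IsBounded) (f : ℝ≥0 → ℂ) : X →ₗ[ℂ] X :=
  if h : f ∈ cosAlgebra then Cos.phillips hCos h.choose else 0

/-- `e` is a regularizer for `f`. -/
def IsRegularizer (Cos : CosineFunction X) (hCos : Cos.IsBounded) (e f : ℝ≥0 → ℂ) : Prop :=
  e ∈ cosAlgebra ∧ e * f ∈ cosAlgebra ∧ Function.Injective (Cos.primary hCos e)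

open Classical in
/-- The extended functional calculus `Φ(f) = f(B) := Φ(e)⁻¹ Φ(e f)`, with `e` any regularizer for
`f`: the unbounded operator with graph `{(x, y) | Φ(e) y = Φ(e f) x}` (a junk value is used
for `f` which are not regularizable). -/
def calculus (Cos : CosineFunction X) (hCos : Cos.IsBounded) (f : ℝ≥0 → ℂ) : X →ₗ.[ℂ] X :=
  if h : ∃ e, Cos.IsRegularizer hCos e f then
    (LinearMap.ker (Cos.primary hCos h.choose ∘ₗ LinearMap.snd ℂ X X
      - Cos.primary hCos (h.choose * f) ∘ₗ LinearMap.fst ℂ X X)).toLinearPMap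
  else ⊥

/-- The operator `B := Φ(|t|)`. -/
def opB (Cos : CosineFunction X) (hCos : Cos.IsBounded) : X →ₗ.[ℂ] X :=
  Cos.calculus hCos (fun t => ((t : ℝ) : ℂ))

/-- The operators `S(s) := [sgn(t) sin(st)](B)`. -/
def opS (Cos : CosineFunction X) (hCos : Cos.IsBounded) (s : ℝ) : X →ₗ.[ℂ] X :=
  Cos.calculus hCos (fun t => ((Real.sign t * Real.sin (s * t) : ℝ) : ℂ))

end CosineFunction

end

/-!
The primary calculus `Φ` is handled through the relation `Represents f T`: the function `f` is a
cosine transform and `Φ(f) = T`. Every complex measure has a density with respect to a finite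
positive measure, and every complex density on a measure space, transported to `ℝ`, is a complex
measure; hence an identity `f(t) = ∫ h(ω) cos(σ(ω) t) dρ(ω)` gives
`Φ(f) x = ∫ h(ω) Cos(σ(ω)) x dρ(ω)` (`represents_integral`). Since a cosine transform determines
the even part of its measure, `Φ` is well defined (`primary_cosTransform`), and the product formula
makes it multiplicative (`Represents.mul`). From then on, operator identities are read off from
identities between scalar symbols (`Represents.unique`).

The resolvent symbol `1 / (1 + t²)` regularizes `t` and `sgn(t) sin(st)`. Indeed
`∫_0^∞ (1 - cos(rt)) / r² dr = π t / 2` for `t ≥ 0`, and the part of this integral over `[0, 1]` is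
`t²` times a cosine transform (`headSymbol`), while the part over `[1, ∞)` is a cosine transform
(`tailSymbol`), so `t / (1 + t²)` is a cosine transform. As `sgn(t) sin(st) = t · (sin(st) / t)`
and `sin(st) / t` is the symbol of `Sin(s)`, one gets `S(s) = B Sin(s)` (`mem_graph_opS_iff`).

For `x ∈ D(A)` an integration by parts turns the truncated principal value integral into
`2 Sin(s)` applied to boundary terms and to `∫_a^b (x - Cos(r) x) / r² dr` (`truncated_eq`). The
boundary terms vanish in the limit because `x - Cos(r) x = O(r²)`, and the limit of the integral is
`headOp (A x) + tailOp x`, which is the operator version of the formula for `π t / 2`.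

On a UMD space, the truncated Hilbert transforms are bounded on `L²(ℝ; X)` uniformly in the
truncation: the truncated kernel `1 / r` differs from a difference of conjugate Poisson kernels by
at most a sum of Poisson kernels, and conjugate Poisson integrals are Poisson integrals of the
Hilbert transform (`exists_eLpNorm_truncHilbert_le_schwartz`). Transference to the truncated
integrals `T(w)` of the orbits rests on `T(w) = T(w - 2s) + 2 Cos(w - s) T(s)`: averaging over
`s ∈ [0, b]` bounds `‖T(w) x‖` by means of `‖T(·) x‖` over intervals of length comparable to `b`,
and these are controlled by the `L²`-bound applied to a piece of the orbit of `x`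
(`norm_truncated_le`). The uniform bound, the density of `D(A)` and the closedness of `S(s)` extend
the representation to all of `X` (`exists_principalValue_of_bound`).
-/

noncomputable section

namespace CosineCalculus

/-! ### Complex measures as densities -/

section Measure

lemma integrable_of_continuous_bounded {E : Type*} [NormedAddCommGroup E] {f : ℝ → E}
    (hf : Continuous f) {M : ℝ} (hM : ∀ s, ‖f s‖ ≤ M) (ν : Measure ℝ) [IsFiniteMeasure ν] : Integrable f ν :=
  Integrable.of_bound hf.aestronglyMeasurable M (Eventually.of_forall hM)

variable {E : Type*} [NormedAddCommGroup E] [NormedSpace ℂ E]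

/-- The Jordan decomposition may be replaced by any decomposition as a difference of finite
positive measures. -/
lemma integral_jordan_eq {s : SignedMeasure ℝ} {P N : Measure ℝ} [IsFiniteMeasure P]
    [IsFiniteMeasure N] (hs : s = P.toSignedMeasure - N.toSignedMeasure) {f : ℝ → E}
    (hf : Continuous f) {M : ℝ} (hM : ∀ s, ‖f s‖ ≤ M) :
    (∫ x, f x ∂s.toJordanDecomposition.posPart) - ∫ x, f x ∂s.toJordanDecomposition.negPart
      = (∫ x, f x ∂P) - ∫ x, f x ∂N := by
  set j := s.toJordanDecomposition with hj
  have h1 : j.posPart.toSignedMeasure - j.negPart.toSignedMeasure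
      = P.toSignedMeasure - N.toSignedMeasure := by
    rw [← hs, ← s.toSignedMeasure_toJordanDecomposition]; rfl
  have h2 : j.posPart + N = P + j.negPart := by
    rw [← Measure.toSignedMeasure_eq_toSignedMeasure_iff, Measure.toSignedMeasure_add,
      Measure.toSignedMeasure_add]
    exact sub_eq_sub_iff_add_eq_add.1 h1
  have hI := fun (ν : Measure ℝ) [IsFiniteMeasure ν] => integrable_of_continuous_bounded hf hM ν
  have h3 : ∫ x, f x ∂(j.posPart + N) = ∫ x, f x ∂(P + j.negPart) := by rw [h2]
  rw [integral_add_measure (hI _) (hI _), integral_add_measure (hI _) (hI _)] at h3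
  exact sub_eq_sub_iff_add_eq_add.2 h3

variable {Ω : Type*} [MeasurableSpace Ω]

/-- The positive part of the real density `h`, transported to `ℝ` along `σ`. -/
def pushPos (ρ : Measure Ω) (h : Ω → ℝ) (σ : Ω → ℝ) : Measure ℝ :=
  (ρ.withDensity fun ω => ENNReal.ofReal (h ω)).map σ

lemma isFiniteMeasure_pushPos {ρ : Measure Ω} {h : Ω → ℝ} (hh : Integrable h ρ) (σ : Ω → ℝ) :
    IsFiniteMeasure (pushPos ρ h σ) := by
  have : IsFiniteMeasure (ρ.withDensity fun ω => ENNReal.ofReal (h ω)) :=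
    isFiniteMeasure_withDensity_ofReal hh.2
  unfold pushPos; infer_instance

lemma integral_pushPos {ρ : Measure Ω} {h : Ω → ℝ} (hh : Integrable h ρ) {σ : Ω → ℝ}
    (hσ : Measurable σ) {f : ℝ → E} (hf : Continuous f) :
    ∫ x, f x ∂(pushPos ρ h σ) = ∫ ω, max (h ω) 0 • f (σ ω) ∂ρ := by
  rw [pushPos, integral_map hσ.aemeasurable hf.aestronglyMeasurable,
    integral_withDensity_eq_integral_toReal_smul₀ hh.1.aemeasurable.ennreal_ofReal
      (Eventually.of_forall fun _ => ENNReal.ofReal_lt_top)]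
  simp_rw [ENNReal.toReal_ofReal']

lemma integrable_density_smul {ρ : Measure Ω} {h : Ω → ℂ} (hh : Integrable h ρ) {σ : Ω → ℝ}
    (hσ : Measurable σ) {f : ℝ → E} (hf : Continuous f) {M : ℝ} (hM : ∀ s, ‖f s‖ ≤ M) :
    Integrable (fun ω => h ω • f (σ ω)) ρ := by
  refine Integrable.mono' (hh.norm.mul_const M)
    (hh.1.smul (hf.comp_stronglyMeasurable hσ.stronglyMeasurable).aestronglyMeasurable)
    (Eventually.of_forall fun ω => ?_)
  rw [norm_smul]
  exact mul_le_mul_of_nonneg_left (hM _) (norm_nonneg _)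

/-- The image on `ℝ` under `σ` of the complex measure `h dρ`, assembled from the positive and
negative parts of the real and imaginary parts of `h`. -/
def densityMeasure (ρ : Measure Ω) (h : Ω → ℂ) (hh : Integrable h ρ) (σ : Ω → ℝ) :
    ComplexMeasure ℝ :=
  haveI := isFiniteMeasure_pushPos hh.re σ
  haveI := isFiniteMeasure_pushPos hh.re.neg σ
  haveI := isFiniteMeasure_pushPos hh.im σ
  haveI := isFiniteMeasure_pushPos hh.im.neg σ
  SignedMeasure.toComplexMeasure
    ((pushPos ρ (fun ω => RCLike.re (h ω)) σ).toSignedMeasure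
      - (pushPos ρ (-fun ω => RCLike.re (h ω)) σ).toSignedMeasure)
    ((pushPos ρ (fun ω => RCLike.im (h ω)) σ).toSignedMeasure
      - (pushPos ρ (-fun ω => RCLike.im (h ω)) σ).toSignedMeasure)

lemma cintegral_densityMeasure {ρ : Measure Ω} {h : Ω → ℂ} (hh : Integrable h ρ) {σ : Ω → ℝ}
    (hσ : Measurable σ) {f : ℝ → E} (hf : Continuous f) {M : ℝ} (hM : ∀ s, ‖f s‖ ≤ M) :
    cintegral (densityMeasure ρ h hh σ) f = ∫ ω, h ω • f (σ ω) ∂ρ := by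
  have := isFiniteMeasure_pushPos hh.re σ
  have := isFiniteMeasure_pushPos hh.re.neg σ
  have := isFiniteMeasure_pushPos hh.im σ
  have := isFiniteMeasure_pushPos hh.im.neg σ
  have key : ∀ g : Ω → ℝ, Integrable g ρ →
      Integrable (fun ω => max (g ω) 0 • f (σ ω)) ρ := by
    intro g hg
    have := integrable_density_smul (ρ := ρ) (h := fun ω => ((max (g ω) 0 : ℝ) : ℂ))
      hg.pos_part.ofReal hσ hf hM
    simpa only [Complex.coe_smul] using this
  have hdiff : ∀ g : Ω → ℝ, Integrable g ρ →
      (∫ ω, max (g ω) 0 • f (σ ω) ∂ρ) - ∫ ω, max ((-g) ω) 0 • f (σ ω) ∂ρ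
        = ∫ ω, g ω • f (σ ω) ∂ρ := by
    intro g hg
    rw [← integral_sub (key g hg) (key (-g) hg.neg)]
    refine integral_congr_ae (Eventually.of_forall fun ω => ?_)
    simp only [← sub_smul, Pi.neg_apply]
    rw [max_zero_sub_max_neg_zero_eq_self]
  have hint : ∀ g : Ω → ℝ, Integrable g ρ → Integrable (fun ω => g ω • f (σ ω)) ρ := by
    intro g hg
    have := integrable_density_smul (ρ := ρ) (h := fun ω => ((g ω : ℝ) : ℂ))
      hg.ofReal hσ hf hM
    simpa only [Complex.coe_smul] using this
  unfold cintegral densityMeasure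
  rw [integral_jordan_eq (SignedMeasure.re_toComplexMeasure _ _) hf hM,
    integral_jordan_eq (SignedMeasure.im_toComplexMeasure _ _) hf hM,
    integral_pushPos hh.re hσ hf, integral_pushPos hh.re.neg hσ hf,
    integral_pushPos hh.im hσ hf, integral_pushPos hh.im.neg hσ hf,
    hdiff _ hh.re, hdiff _ hh.im, ← integral_smul]
  refine (integral_add (hint _ hh.re) ((hint _ hh.im).smul _)).symm.trans ?_
  refine integral_congr_ae (Eventually.of_forall fun ω => ?_)
  simp only [Pi.smul_apply, RCLike.re_to_complex, RCLike.im_to_complex, ← Complex.coe_smul,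
    smul_smul, ← add_smul]
  congr 1
  rw [mul_comm]; exact Complex.re_add_im _

/-- The sum of the four positive measures that constitute a complex measure. -/
def jordanSum (μ : ComplexMeasure ℝ) : Measure ℝ :=
  ((ComplexMeasure.re μ).toJordanDecomposition.posPart
    + (ComplexMeasure.re μ).toJordanDecomposition.negPart)
  + ((ComplexMeasure.im μ).toJordanDecomposition.posPart
    + (ComplexMeasure.im μ).toJordanDecomposition.negPart)

instance (μ : ComplexMeasure ℝ) : IsFiniteMeasure (jordanSum μ) := by
  unfold jordanSum; infer_instance

/-- The density of a complex measure with respect to `jordanSum`. -/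
def jordanDensity (μ : ComplexMeasure ℝ) (s : ℝ) : ℂ :=
  ((((ComplexMeasure.re μ).toJordanDecomposition.posPart.rnDeriv (jordanSum μ) s).toReal
    - ((ComplexMeasure.re μ).toJordanDecomposition.negPart.rnDeriv (jordanSum μ) s).toReal : ℝ) : ℂ)
  + Complex.I *
    ((((ComplexMeasure.im μ).toJordanDecomposition.posPart.rnDeriv (jordanSum μ) s).toReal
    - ((ComplexMeasure.im μ).toJordanDecomposition.negPart.rnDeriv (jordanSum μ) s).toReal : ℝ) : ℂ)

lemma integrable_jordanDensity (μ : ComplexMeasure ℝ) :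
    Integrable (jordanDensity μ) (jordanSum μ) := by
  unfold jordanDensity
  exact (Integrable.ofReal (Measure.integrable_toReal_rnDeriv.sub
    Measure.integrable_toReal_rnDeriv)).add
    ((Integrable.ofReal (Measure.integrable_toReal_rnDeriv.sub
      Measure.integrable_toReal_rnDeriv)).const_mul _)

lemma cintegral_eq_integral_jordanDensity (μ : ComplexMeasure ℝ) {f : ℝ → E} (hf : Continuous f)
    {M : ℝ} (hM : ∀ s, ‖f s‖ ≤ M) :
    cintegral μ f = ∫ s, jordanDensity μ s • f s ∂(jordanSum μ) := by
  have h1 : (ComplexMeasure.re μ).toJordanDecomposition.posPart ≪ jordanSum μ :=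
    Measure.absolutelyContinuous_of_le (by
      unfold jordanSum; exact le_trans (Measure.le_add_right le_rfl) (Measure.le_add_right le_rfl))
  have h2 : (ComplexMeasure.re μ).toJordanDecomposition.negPart ≪ jordanSum μ :=
    Measure.absolutelyContinuous_of_le (by
      unfold jordanSum; exact le_trans (Measure.le_add_left le_rfl) (Measure.le_add_right le_rfl))
  have h3 : (ComplexMeasure.im μ).toJordanDecomposition.posPart ≪ jordanSum μ :=
    Measure.absolutelyContinuous_of_le (by
      unfold jordanSum; exact le_trans (Measure.le_add_right le_rfl) (Measure.le_add_left le_rfl))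
  have h4 : (ComplexMeasure.im μ).toJordanDecomposition.negPart ≪ jordanSum μ :=
    Measure.absolutelyContinuous_of_le (by
      unfold jordanSum; exact le_trans (Measure.le_add_left le_rfl) (Measure.le_add_left le_rfl))
  have hint : ∀ ν : Measure ℝ, IsFiniteMeasure ν → ν ≪ jordanSum μ →
      Integrable (fun s => (ν.rnDeriv (jordanSum μ) s).toReal • f s) (jordanSum μ) := by
    intro ν _ _
    have := integrable_density_smul (ρ := jordanSum μ)
      (h := fun s => (((ν.rnDeriv (jordanSum μ) s).toReal : ℝ) : ℂ))
      (Measure.integrable_toReal_rnDeriv.ofReal) measurable_id hf hM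
    simpa only [Complex.coe_smul, id] using this
  unfold cintegral
  rw [← integral_rnDeriv_smul h1, ← integral_rnDeriv_smul h2, ← integral_rnDeriv_smul h3,
    ← integral_rnDeriv_smul h4, ← integral_sub (hint _ inferInstance h1) (hint _ inferInstance h2),
    ← integral_sub (hint _ inferInstance h3) (hint _ inferInstance h4), ← integral_smul]
  refine (integral_add ((hint _ inferInstance h1).sub (hint _ inferInstance h2))
      (((hint _ inferInstance h3).sub (hint _ inferInstance h4)).smul _)).symm.trans ?_
  refine integral_congr_ae (Eventually.of_forall fun s => ?_)
  simp only [jordanDensity, Pi.smul_apply, Pi.sub_apply, Complex.ofReal_sub, ← sub_smul,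
    ← Complex.coe_smul, smul_smul, ← add_smul]

/-! ### Uniqueness of the cosine transform -/

/-- An even function integrates equally against two finite measures with the same cosine transform,
since their symmetrisations have the same characteristic function. -/
lemma integral_eq_of_integral_cos_eq {P N : Measure ℝ} [IsFiniteMeasure P] [IsFiniteMeasure N]
    (h : ∀ t : ℝ≥0, ∫ s, Real.cos (s * t) ∂P = ∫ s, Real.cos (s * t) ∂N)
    {f : ℝ → E} (hf : Continuous f) {M : ℝ} (hM : ∀ s, ‖f s‖ ≤ M) (heven : ∀ s, f (-s) = f s) :
    ∫ s, f s ∂P = ∫ s, f s ∂N := by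
  have h' : ∀ t : ℝ, ∫ s, Real.cos (s * t) ∂P = ∫ s, Real.cos (s * t) ∂N := by
    intro t
    rcases le_total 0 t with ht | ht
    · exact h ⟨t, ht⟩
    · have h2 : ∫ s, Real.cos (s * -t) ∂P = ∫ s, Real.cos (s * -t) ∂N := h ⟨-t, neg_nonneg.2 ht⟩
      simpa using h2
  have hchar : ∀ (Q : Measure ℝ) [IsFiniteMeasure Q] (t : ℝ),
      charFun (Q + Q.map Neg.neg) t = ((2 * ∫ s, Real.cos (s * t) ∂Q : ℝ) : ℂ) := by
    intro Q _ t
    have hb : ∀ s : ℝ, ‖Complex.exp (t * s * Complex.I)‖ ≤ 1 := by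
      intro s
      rw [← Complex.ofReal_mul, Complex.norm_exp_ofReal_mul_I]
    have hc : Continuous fun s : ℝ => Complex.exp (t * s * Complex.I) := by fun_prop
    have hI := fun (ν : Measure ℝ) [IsFiniteMeasure ν] => integrable_of_continuous_bounded hc hb ν
    rw [charFun_apply_real, integral_add_measure (hI _) (hI _),
      integral_map measurable_neg.aemeasurable hc.aestronglyMeasurable,
      ← integral_add (hI _)]
    · rw [← integral_const_mul, ← integral_complex_ofReal]
      refine integral_congr_ae (Eventually.of_forall fun s => ?_)
      simp only
      push_cast
      rw [Complex.cos]
      ring_nf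
    · refine integrable_of_continuous_bounded (by fun_prop) (M := 1) (fun s => ?_) Q
      exact hb (-s)
  have heq : P + P.map Neg.neg = N + N.map Neg.neg := by
    refine Measure.ext_of_charFun ?_
    ext t
    rw [hchar, hchar, h' t]
  have hI := fun (ν : Measure ℝ) [IsFiniteMeasure ν] => integrable_of_continuous_bounded hf hM ν
  have hval : ∀ (Q : Measure ℝ) [IsFiniteMeasure Q],
      ∫ s, f s ∂(Q + Q.map Neg.neg) = (2 : ℂ) • ∫ s, f s ∂Q := by
    intro Q _
    rw [integral_add_measure (hI _) (hI _),
      integral_map measurable_neg.aemeasurable hf.aestronglyMeasurable]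
    simp only [heven, two_smul]
  have h2 := hval P
  rw [heq, hval N] at h2
  exact (smul_right_injective E (two_ne_zero' ℂ) h2).symm

lemma cintegral_eq_of_cosTransform_eq {μ ν : ComplexMeasure ℝ}
    (h : cosTransform μ = cosTransform ν) {f : ℝ → E} (hf : Continuous f) {M : ℝ}
    (hM : ∀ s, ‖f s‖ ≤ M) (heven : ∀ s, f (-s) = f s) : cintegral μ f = cintegral ν f := by
  have hcos : ∀ t : ℝ≥0, Continuous fun s : ℝ => Real.cos (s * t) := fun t => by fun_prop
  have hI : ∀ (t : ℝ≥0) (Q : Measure ℝ) [IsFiniteMeasure Q],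
      Integrable (fun s : ℝ => Real.cos (s * t)) Q := fun t Q _ =>
    Integrable.of_bound (hcos t).aestronglyMeasurable 1
      (Eventually.of_forall fun s => Real.abs_cos_le_one _)
  have hIf := fun (Q : Measure ℝ) [IsFiniteMeasure Q] => integrable_of_continuous_bounded hf hM Q
  -- Differences of positive measures are compared by moving the negative parts across.
  have key : ∀ {p n p' n' : Measure ℝ} [IsFiniteMeasure p] [IsFiniteMeasure n]
      [IsFiniteMeasure p'] [IsFiniteMeasure n'],
      (∀ t : ℝ≥0, (∫ s, Real.cos (s * t) ∂p) - ∫ s, Real.cos (s * t) ∂n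
        = (∫ s, Real.cos (s * t) ∂p') - ∫ s, Real.cos (s * t) ∂n') →
      (∫ s, f s ∂p) - ∫ s, f s ∂n = (∫ s, f s ∂p') - ∫ s, f s ∂n' := by
    intro p n p' n' _ _ _ _ hh
    have := integral_eq_of_integral_cos_eq (P := p + n') (N := p' + n) (fun t => by
      rw [integral_add_measure (hI _ _) (hI _ _), integral_add_measure (hI _ _) (hI _ _)]
      linarith [hh t]) hf hM heven
    rw [integral_add_measure (hIf _) (hIf _), integral_add_measure (hIf _) (hIf _)] at this
    exact sub_eq_sub_iff_add_eq_add.2 this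
  have hre := fun t => congrArg Complex.re (congrFun h t)
  have him := fun t => congrArg Complex.im (congrFun h t)
  simp only [cosTransform, cintegral, integral_complex_ofReal, smul_eq_mul, Complex.add_re,
    Complex.add_im, Complex.sub_re, Complex.sub_im, Complex.mul_re, Complex.mul_im,
    Complex.I_re, Complex.I_im, Complex.ofReal_re, Complex.ofReal_im, zero_mul, one_mul,
    sub_self, add_zero, zero_add, mul_zero] at hre him
  unfold cintegral
  rw [key hre, key him]

end Measure

end CosineCalculus

namespace CosineFunction

open CosineCalculus

/-! ### The primary calculus -/

section Primary

variable {X : Type*} [NormedAddCommGroup X] [NormedSpace ℂ X]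
  (Cos : CosineFunction X) (hCos : Cos.IsBounded)

lemma map_neg (s : ℝ) (x : X) : Cos (-s) x = Cos s x := by
  have h := Cos.map_add_add_map_sub 0 s x
  rw [Cos.map_zero, zero_add, zero_sub, two_smul] at h
  simpa using h

/-- `f` belongs to `ℰ(ℝ₊)` and `Φ(f) = T`. The operator `T` is a bare function, so that it can be
given by an explicit integral; linearity and boundedness are inherited from `Φ(f)`. -/
def Represents (f : ℝ≥0 → ℂ) (T : X → X) : Prop :=
  f ∈ cosAlgebra ∧ ∀ x, Cos.primary hCos f x = T x

/-- The primary calculus does not depend on the representing measure. -/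
lemma primary_cosTransform (μ : ComplexMeasure ℝ) :
    Cos.primary hCos (cosTransform μ) = Cos.phillips hCos μ := by
  have h : cosTransform μ ∈ cosAlgebra := ⟨μ, rfl⟩
  obtain ⟨M, hM⟩ := id hCos
  rw [primary, dif_pos h]
  ext x
  exact cintegral_eq_of_cosTransform_eq h.choose_spec (Cos.strongly_continuous x)
    (fun s => (Cos s).le_of_opNorm_le (hM s) x) fun s => Cos.map_neg s x

variable {Cos hCos}

lemma represents_primary {f : ℝ≥0 → ℂ} (hf : f ∈ cosAlgebra) :
    Cos.Represents hCos f (Cos.primary hCos f) := ⟨hf, fun _ => rfl⟩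

lemma continuous_cos_mul (t : ℝ≥0) : Continuous fun s : ℝ => ((Real.cos (s * t) : ℝ) : ℂ) := by
  fun_prop

lemma norm_cos_mul_le (t : ℝ≥0) (s : ℝ) : ‖((Real.cos (s * t) : ℝ) : ℂ)‖ ≤ 1 := by
  rw [Complex.norm_real]; exact Real.abs_cos_le_one _

section Density

variable {Ω : Type*} [MeasurableSpace Ω] {ρ : Measure Ω} {h : Ω → ℂ} {σ : Ω → ℝ}

lemma integrable_density_cos (hh : Integrable h ρ) (hσ : Measurable σ) (t : ℝ≥0) :
    Integrable (fun ω => h ω * ((Real.cos (σ ω * t) : ℝ) : ℂ)) ρ :=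
  integrable_density_smul hh hσ (continuous_cos_mul t) (norm_cos_mul_le t)

lemma integrable_density_orbit (hCos : Cos.IsBounded) (hh : Integrable h ρ)
    (hσ : Measurable σ) (x : X) : Integrable (fun ω => h ω • Cos (σ ω) x) ρ := by
  obtain ⟨M, hM⟩ := hCos
  exact integrable_density_smul hh hσ (Cos.strongly_continuous x)
    (fun s => (Cos s).le_of_opNorm_le (hM s) x)

/-- The primary calculus for the complex measure `h dρ`, transported to `ℝ` by `σ`. -/
lemma represents_integral (hh : Integrable h ρ) (hσ : Measurable σ) :
    Cos.Represents hCos (fun t : ℝ≥0 => ∫ ω, h ω * ((Real.cos (σ ω * t) : ℝ) : ℂ) ∂ρ)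
      (fun x => ∫ ω, h ω • Cos (σ ω) x ∂ρ) := by
  have hf : (fun t : ℝ≥0 => ∫ ω, h ω * ((Real.cos (σ ω * t) : ℝ) : ℂ) ∂ρ)
      = cosTransform (densityMeasure ρ h hh σ) := by
    ext t
    exact (cintegral_densityMeasure hh hσ (continuous_cos_mul t) (norm_cos_mul_le t)).symm
  refine ⟨⟨_, hf.symm⟩, fun x => ?_⟩
  rw [hf, primary_cosTransform]
  obtain ⟨M, hM⟩ := hCos
  exact cintegral_densityMeasure hh hσ (Cos.strongly_continuous x)
    (fun s => (Cos s).le_of_opNorm_le (hM s) x)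

end Density

variable {f g : ℝ≥0 → ℂ} {S T : X → X}

lemma Represents.exists_density (hf : Cos.Represents hCos f T) :
    ∃ (ρ : Measure ℝ) (_ : IsFiniteMeasure ρ) (h : ℝ → ℂ) (_ : Integrable h ρ),
      (∀ t, f t = ∫ s, h s * ((Real.cos (s * t) : ℝ) : ℂ) ∂ρ) ∧
        ∀ x, T x = ∫ s, h s • Cos s x ∂ρ := by
  obtain ⟨⟨μ, rfl⟩, hT⟩ := hf
  refine ⟨jordanSum μ, inferInstance, jordanDensity μ, integrable_jordanDensity μ, fun t => ?_,
    fun x => ?_⟩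
  · exact cintegral_eq_integral_jordanDensity μ (continuous_cos_mul t) (norm_cos_mul_le t)
  · rw [← hT, primary_cosTransform]
    obtain ⟨M, hM⟩ := hCos
    exact cintegral_eq_integral_jordanDensity μ (Cos.strongly_continuous x)
      (fun s => (Cos s).le_of_opNorm_le (hM s) x)

lemma Represents.congr (hf : Cos.Represents hCos f T) (hfg : ∀ t, f t = g t)
    (hST : ∀ x, T x = S x) : Cos.Represents hCos g S := by
  obtain rfl : f = g := funext hfg
  obtain rfl : T = S := funext hST
  exact hf

lemma Represents.unique (hf : Cos.Represents hCos f T) (hg : Cos.Represents hCos g S)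
    (hfg : ∀ t, f t = g t) (x : X) : T x = S x := by
  obtain rfl : f = g := funext hfg
  rw [← hf.2, hg.2]

lemma Represents.linear_combination (hf : Cos.Represents hCos f T) (hg : Cos.Represents hCos g S)
    (a b : ℂ) :
    Cos.Represents hCos (fun t => a * f t + b * g t) (fun x => a • T x + b • S x) := by
  obtain ⟨ρ, _, h, hh, hfh, hTh⟩ := hf.exists_density
  obtain ⟨κ, _, k, hk, hgk, hSk⟩ := hg.exists_density
  have hl : MeasurableEmbedding (Sum.inl : ℝ → ℝ ⊕ ℝ) :=
    ⟨Sum.inl_injective, measurable_inl, fun _ hs => hs.inl_image⟩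
  have hr : MeasurableEmbedding (Sum.inr : ℝ → ℝ ⊕ ℝ) :=
    ⟨Sum.inr_injective, measurable_inr, fun _ hs => hs.inr_image⟩
  -- The sum of the two measures is realized as one density on the disjoint union of two lines.
  set H : ℝ ⊕ ℝ → ℂ := Sum.elim (fun s => a * h s) (fun s => b * k s) with hH
  have hHl : Integrable H (ρ.map Sum.inl) := by
    rw [hl.integrable_map_iff]; exact hh.const_mul a
  have hHr : Integrable H (κ.map Sum.inr) := by
    rw [hr.integrable_map_iff]; exact hk.const_mul b
  have hσ : Measurable (Sum.elim (id : ℝ → ℝ) (id : ℝ → ℝ)) := measurable_id.sumElim measurable_id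
  refine (represents_integral (Cos := Cos) (hCos := hCos) (hHl.add_measure hHr) hσ).congr
    (fun t => ?_) (fun x => ?_)
  · rw [integral_add_measure (integrable_density_cos hHl hσ t) (integrable_density_cos hHr hσ t),
      hl.integral_map, hr.integral_map, hfh, hgk, ← integral_const_mul, ← integral_const_mul]
    simp only [hH, Sum.elim_inl, Sum.elim_inr, id, mul_assoc]
  · rw [integral_add_measure (integrable_density_orbit hCos hHl hσ x)
      (integrable_density_orbit hCos hHr hσ x),
      hl.integral_map, hr.integral_map, hTh, hSk, ← integral_smul, ← integral_smul]
    simp only [hH, Sum.elim_inl, Sum.elim_inr, id, mul_smul]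

lemma Represents.add (hf : Cos.Represents hCos f T) (hg : Cos.Represents hCos g S) :
    Cos.Represents hCos (fun t => f t + g t) (fun x => T x + S x) :=
  (hf.linear_combination hg 1 1).congr (fun _ => by simp) (fun _ => by simp)

lemma Represents.sub (hf : Cos.Represents hCos f T) (hg : Cos.Represents hCos g S) :
    Cos.Represents hCos (fun t => f t - g t) (fun x => T x - S x) :=
  (hf.linear_combination hg 1 (-1)).congr (fun _ => by ring) (fun _ => by module)

lemma Represents.smul (hf : Cos.Represents hCos f T) (a : ℂ) :
    Cos.Represents hCos (fun t => a * f t) (fun x => a • T x) :=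
  (hf.linear_combination hf a 0).congr (fun _ => by ring) (fun _ => by module)

lemma represents_cos [CompleteSpace X] (s : ℝ) :
    Cos.Represents hCos (fun t : ℝ≥0 => ((Real.cos (s * t) : ℝ) : ℂ)) (fun x => Cos s x) :=
  (represents_integral (ρ := Measure.dirac s) (h := fun _ => 1) (integrable_const _)
    measurable_id).congr (fun t => by simp) (fun x => by simp [integral_dirac])

lemma represents_one [CompleteSpace X] : Cos.Represents hCos (fun _ => 1) (fun x => x) :=
  (represents_cos 0).congr (fun t => by simp) (fun x => by simp [Cos.map_zero])

/-- The primary calculus is multiplicative, by the product formula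
`2 cos a cos b = cos (a + b) + cos (a - b)` for scalars and for the cosine function. -/
lemma Represents.mul [CompleteSpace X] (hf : Cos.Represents hCos f T)
    (hg : Cos.Represents hCos g S) :
    Cos.Represents hCos (fun t => f t * g t) (fun x => T (S x)) := by
  obtain ⟨ρ, _, h, hh, hfh, hTh⟩ := hf.exists_density
  obtain ⟨κ, _, k, hk, hgk, hSk⟩ := hg.exists_density
  have hhk : Integrable (fun p : ℝ × ℝ => (2⁻¹ : ℂ) * (h p.1 * k p.2)) (ρ.prod κ) :=
    (hh.mul_prod hk).const_mul _
  have hadd : Measurable fun p : ℝ × ℝ => p.1 + p.2 := by fun_prop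
  have hsub : Measurable fun p : ℝ × ℝ => p.1 - p.2 := by fun_prop
  have hcos : ∀ s r : ℝ, ∀ x : X, Cos s (Cos r x) = (2⁻¹ : ℂ) • (Cos (s + r) x + Cos (s - r) x) := by
    intro s r x
    rw [Cos.map_add_add_map_sub, smul_smul]; norm_num
  refine ((represents_integral (Cos := Cos) (hCos := hCos) hhk hadd).add
    (represents_integral hhk hsub)).congr (fun t => ?_) (fun x => ?_)
  · rw [← integral_add (integrable_density_cos hhk hadd t) (integrable_density_cos hhk hsub t),
      hfh, hgk, ← integral_prod_mul]
    refine integral_congr_ae (Eventually.of_forall fun p => ?_)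
    simp only [add_mul, sub_mul, Real.cos_add, Real.cos_sub]
    push_cast
    ring
  · have hi := (integrable_density_orbit hCos hhk hadd x).add
      (integrable_density_orbit hCos hhk hsub x)
    rw [← integral_add (integrable_density_orbit hCos hhk hadd x)
      (integrable_density_orbit hCos hhk hsub x)]
    refine (integral_prod _ hi).trans ?_
    rw [hTh, hSk]
    refine integral_congr_ae (Eventually.of_forall fun s => ?_)
    simp only [Pi.add_apply]
    have hki : Integrable (fun r => k r • Cos r x) κ :=
      integrable_density_orbit hCos hk measurable_id x
    rw [← ContinuousLinearMap.integral_comp_comm _ hki, ← integral_smul]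
    refine integral_congr_ae (Eventually.of_forall fun r => ?_)
    simp only [map_smul, hcos]
    module

lemma Represents.comm [CompleteSpace X] (hf : Cos.Represents hCos f T)
    (hg : Cos.Represents hCos g S) (x : X) : T (S x) = S (T x) :=
  (hf.mul hg).unique (hg.mul hf) (fun _ => mul_comm _ _) x

lemma Represents.exists_norm_le (hf : Cos.Represents hCos f T) :
    ∃ K : ℝ, ∀ x, ‖T x‖ ≤ K * ‖x‖ := by
  obtain ⟨ρ, _, h, hh, -, hTh⟩ := hf.exists_density
  obtain ⟨M, hM⟩ := id hCos
  refine ⟨(∫ s, ‖h s‖ ∂ρ) * M, fun x => ?_⟩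
  rw [hTh, mul_assoc, ← integral_mul_const]
  refine norm_integral_le_of_norm_le (hh.norm.mul_const _) (Eventually.of_forall fun s => ?_)
  rw [norm_smul]
  exact mul_le_mul_of_nonneg_left ((Cos s).le_of_opNorm_le (hM s) x) (norm_nonneg _)

lemma continuous_primary (hf : f ∈ cosAlgebra) : Continuous (Cos.primary hCos f) := by
  obtain ⟨K, hK⟩ := (represents_primary (Cos := Cos) (hCos := hCos) hf).exists_norm_le
  exact AddMonoidHomClass.continuous_of_bound _ K hK

end Primary

/-! ### The extended calculus -/

section Extended

variable {X : Type*} [NormedAddCommGroup X] [NormedSpace ℂ X] [CompleteSpace X]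
  {Cos : CosineFunction X} {hCos : Cos.IsBounded}

/-- The extended calculus can be computed with any regularizer. -/
lemma mem_graph_calculus_iff {e f : ℝ≥0 → ℂ} (he : Cos.IsRegularizer hCos e f) {x y : X} :
    (x, y) ∈ (Cos.calculus hCos f).graph
      ↔ Cos.primary hCos e y = Cos.primary hCos (e * f) x := by
  have h : ∃ e, Cos.IsRegularizer hCos e f := ⟨e, he⟩
  have hc : Cos.IsRegularizer hCos h.choose f := h.choose_spec
  rw [calculus, dif_pos h, Submodule.toLinearPMap_graph_eq]
  · generalize h.choose = e' at hc
    simp only [LinearMap.mem_ker, LinearMap.sub_apply, LinearMap.comp_apply, LinearMap.snd_apply,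
      LinearMap.fst_apply, sub_eq_zero]
    have key : ∀ {a b : ℝ≥0 → ℂ}, Cos.IsRegularizer hCos a f → Cos.IsRegularizer hCos b f →
        Cos.primary hCos a y = Cos.primary hCos (a * f) x →
        Cos.primary hCos b y = Cos.primary hCos (b * f) x := by
      intro a b ha hb hab
      refine ha.2.2 ?_
      rw [(represents_primary ha.1).comm (represents_primary hb.1), hab]
      refine ((represents_primary hb.1).mul (represents_primary ha.2.1)).unique
        ((represents_primary ha.1).mul (represents_primary hb.2.1)) (fun t => ?_) x
      simp only [Pi.mul_apply]; ring
    exact ⟨key hc he, key he hc⟩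
  · rintro ⟨a, b⟩ hab (rfl : a = 0)
    simp only [LinearMap.mem_ker, LinearMap.sub_apply, LinearMap.comp_apply, LinearMap.snd_apply,
      LinearMap.fst_apply, _root_.map_zero, sub_zero] at hab
    exact hc.2.2 (hab.trans (_root_.map_zero _).symm)

lemma isClosed_graph_calculus {e f : ℝ≥0 → ℂ} (he : Cos.IsRegularizer hCos e f) :
    IsClosed {p : X × X | p ∈ (Cos.calculus hCos f).graph} := by
  have : {p : X × X | p ∈ (Cos.calculus hCos f).graph}
      = {p | Cos.primary hCos e p.2 = Cos.primary hCos (e * f) p.1} := by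
    ext ⟨x, y⟩; exact mem_graph_calculus_iff he
  rw [this]
  exact isClosed_eq ((continuous_primary he.1).comp continuous_snd)
    ((continuous_primary he.2.1).comp continuous_fst)

end Extended

end CosineFunction

namespace CosineCalculus

/-! ### Scalar integrals -/

lemma integrableOn_exp_neg_mul_cos (t : ℝ) :
    IntegrableOn (fun r : ℝ => Real.exp (-r) * Real.cos (r * t)) (Set.Ioi 0) := by
  refine Integrable.mono' (integrableOn_exp_neg_Ioi 0) (by fun_prop) (Eventually.of_forall fun r => ?_)
  rw [Real.norm_eq_abs, abs_mul, abs_of_pos (Real.exp_pos _)]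
  exact mul_le_of_le_one_right (Real.exp_pos _).le (Real.abs_cos_le_one _)

lemma integral_exp_neg_mul_cos (t : ℝ) :
    ∫ r in Set.Ioi (0 : ℝ), Real.exp (-r) * Real.cos (r * t) = (1 + t ^ 2)⁻¹ := by
  have ha : ((-1 : ℂ) + t * Complex.I).re < 0 := by simp
  have h := integral_exp_mul_complex_Ioi ha 0
  have hi := integrableOn_exp_mul_complex_Ioi ha 0
  have h2 := Complex.reCLM.integral_comp_comm hi
  rw [h] at h2
  have h3 : ∀ r : ℝ, Complex.reCLM (Complex.exp ((-1 + t * Complex.I) * r))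
      = Real.exp (-r) * Real.cos (r * t) := by
    intro r
    simp [Complex.exp_re, mul_comm]
  simp only [h3] at h2
  rw [h2]
  simp [Complex.div_re, Complex.normSq_apply]
  field_simp

/-- `∫_0^s cos (r t) dr`, which is `sin (s t) / t` for `t ≠ 0`. -/
def sineSymbol (s t : ℝ) : ℝ := ∫ r in (0 : ℝ)..s, Real.cos (r * t)

lemma mul_sineSymbol (s t : ℝ) : t * sineSymbol s t = Real.sin (s * t) := by
  rw [sineSymbol, ← intervalIntegral.integral_const_mul]
  have h : ∀ r ∈ Set.uIcc 0 s, HasDerivAt (fun r => Real.sin (r * t)) (t * Real.cos (r * t)) r := by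
    intro r _
    have := (Real.hasDerivAt_sin (r * t)).comp r ((hasDerivAt_id r).mul_const t)
    refine this.congr_deriv ?_
    simp [mul_comm]
  rw [intervalIntegral.integral_eq_sub_of_hasDerivAt h
    (Continuous.intervalIntegrable (by fun_prop) _ _)]
  simp

/-- `∫_0^1 (1 - v) cos (r v t) dv`, which is `(1 - cos (r t)) / (r t)²` for `r t ≠ 0`. -/
def meanSymbol (r t : ℝ) : ℝ := ∫ v in (0 : ℝ)..1, (1 - v) * Real.cos (r * v * t)

lemma sq_mul_meanSymbol (r t : ℝ) : (r * t) ^ 2 * meanSymbol r t = 1 - Real.cos (r * t) := by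
  rw [meanSymbol, ← intervalIntegral.integral_const_mul]
  have h : ∀ v ∈ Set.uIcc (0 : ℝ) 1, HasDerivAt
      (fun v => (1 - v) * (r * t * Real.sin (r * v * t)) - Real.cos (r * v * t))
      ((r * t) ^ 2 * ((1 - v) * Real.cos (r * v * t))) v := by
    intro v _
    have h0 : HasDerivAt (fun v : ℝ => r * v * t) (r * t) v := by
      simpa using ((hasDerivAt_id v).const_mul r).mul_const t
    have h1 := (Real.hasDerivAt_sin (r * v * t)).comp v h0
    have h2 := (Real.hasDerivAt_cos (r * v * t)).comp v h0
    have h3 := (((hasDerivAt_const v (1 : ℝ)).sub (hasDerivAt_id v)).mul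
      (h1.const_mul (r * t))).sub h2
    refine h3.congr_deriv ?_
    simp only [Function.comp_apply, id, Pi.sub_apply]
    ring
  rw [intervalIntegral.integral_eq_sub_of_hasDerivAt h
    (Continuous.intervalIntegrable (by fun_prop) _ _)]
  simp
  ring

/-- `∫_0^1 meanSymbol r t dr`, which is `t⁻² ∫_0^1 (1 - cos (r t)) / r² dr` for `t ≠ 0`. -/
def headSymbol (t : ℝ) : ℝ := ∫ r in (0 : ℝ)..1, meanSymbol r t

/-- `∫_1^∞ (1 - cos (r t)) / r² dr`, with the integral of the constant term evaluated. -/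
def tailSymbol (t : ℝ) : ℝ := 1 - ∫ r in Set.Ioi (1 : ℝ), (r ^ 2)⁻¹ * Real.cos (r * t)

lemma integrableOn_inv_sq : IntegrableOn (fun r : ℝ => (r ^ 2)⁻¹) (Set.Ioi 1) := by
  have := integrableOn_Ioi_rpow_of_lt (a := -2) (by norm_num) (zero_lt_one' ℝ)
  refine this.congr_fun (fun r hr => ?_) measurableSet_Ioi
  simp only
  rw [Real.rpow_neg (zero_le_one.trans (le_of_lt hr)), Real.rpow_two]

lemma integral_inv_sq : ∫ r in Set.Ioi (1 : ℝ), (r ^ 2)⁻¹ = 1 := by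
  have := integral_Ioi_rpow_of_lt (a := -2) (by norm_num) (zero_lt_one' ℝ)
  rw [setIntegral_congr_fun (g := fun r : ℝ => r ^ (-2 : ℝ)) measurableSet_Ioi, this]
  · norm_num
  · intro r hr
    simp only
    rw [Real.rpow_neg (zero_le_one.trans (le_of_lt hr)), Real.rpow_two]

lemma integrableOn_inv_sq_mul_cos (t : ℝ) :
    IntegrableOn (fun r : ℝ => (r ^ 2)⁻¹ * Real.cos (r * t)) (Set.Ioi 1) := by
  refine Integrable.mono' integrableOn_inv_sq (by fun_prop) (Eventually.of_forall fun r => ?_)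
  rw [Real.norm_eq_abs, abs_mul, abs_of_nonneg (by positivity)]
  exact mul_le_of_le_one_right (by positivity) (Real.abs_cos_le_one _)

lemma one_sub_cos_div_sq_nonneg (r : ℝ) : 0 ≤ (1 - Real.cos r) / r ^ 2 :=
  div_nonneg (by linarith [Real.cos_le_one r]) (sq_nonneg r)

lemma integrableOn_one_sub_cos :
    IntegrableOn (fun r : ℝ => (1 - Real.cos r) / r ^ 2) (Set.Ioi 0) := by
  rw [← Set.Ioc_union_Ioi_eq_Ioi (zero_le_one' ℝ)]
  refine IntegrableOn.union ?_ ?_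
  · refine Integrable.mono' (g := fun _ => 1 / 2) (by simp)
      (Measurable.aestronglyMeasurable (by fun_prop)) ?_
    filter_upwards [ae_restrict_mem measurableSet_Ioc] with r hr
    rw [Real.norm_eq_abs, abs_of_nonneg (one_sub_cos_div_sq_nonneg r),
      div_le_iff₀ (pow_pos hr.1 2)]
    linarith [Real.one_sub_sq_div_two_le_cos (x := r)]
  · refine (integrableOn_inv_sq.sub (integrableOn_inv_sq_mul_cos 1)).congr_fun (fun r _ => ?_)
      measurableSet_Ioi
    simp only [Pi.sub_apply, mul_one]
    ring

lemma integral_one_sub_cos_mul {t : ℝ} (ht : 0 ≤ t) :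
    ∫ r in Set.Ioi (0 : ℝ), (1 - Real.cos (r * t)) / r ^ 2
      = t * ∫ r in Set.Ioi (0 : ℝ), (1 - Real.cos r) / r ^ 2 := by
  rcases ht.eq_or_lt with rfl | ht
  · simp
  have h := integral_comp_mul_right_Ioi (fun r => (1 - Real.cos r) / r ^ 2) 0 ht
  rw [zero_mul, smul_eq_mul] at h
  have h2 : ∀ r, (1 - Real.cos (r * t)) / r ^ 2
      = t ^ 2 * ((1 - Real.cos (r * t)) / (r * t) ^ 2) := by
    intro r
    rw [mul_pow]
    field_simp
  simp_rw [h2]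
  rw [integral_const_mul, h]
  field_simp

/-- The value `c` of the integral follows from `t ∫_0^∞ (1 - cos r) / r² dr
= ∫_0^∞ (1 - cos (r t)) / r² dr` by integrating both sides against `e^{-t} dt`. -/
lemma integral_one_sub_cos : ∫ r in Set.Ioi (0 : ℝ), (1 - Real.cos r) / r ^ 2 = Real.pi / 2 := by
  set c := ∫ r in Set.Ioi (0 : ℝ), (1 - Real.cos r) / r ^ 2
  have hinner : ∀ r : ℝ, 0 < r →
      ∫ t in Set.Ioi (0 : ℝ), Real.exp (-t) * ((1 - Real.cos (r * t)) / r ^ 2)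
        = (1 + r ^ 2)⁻¹ := by
    intro r hr
    have h1 : ∀ t : ℝ, Real.exp (-t) * ((1 - Real.cos (r * t)) / r ^ 2)
        = (r ^ 2)⁻¹ * (Real.exp (-t) - Real.exp (-t) * Real.cos (t * r)) := by
      intro t; rw [mul_comm t r]; ring
    simp_rw [h1]
    rw [integral_const_mul, integral_sub (integrableOn_exp_neg_Ioi 0) (integrableOn_exp_neg_mul_cos r),
      integral_exp_neg_mul_cos, integral_exp_neg_Ioi_zero]
    have : (1 + r ^ 2) ≠ 0 := by positivity
    field_simp
    ring
  have hnn : ∀ r t : ℝ, 0 ≤ Real.exp (-t) * ((1 - Real.cos (r * t)) / r ^ 2) := by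
    intro r t
    refine mul_nonneg (Real.exp_pos _).le (div_nonneg ?_ (sq_nonneg r))
    linarith [Real.cos_le_one (r * t)]
  have hprod : Integrable
      (fun p : ℝ × ℝ => Real.exp (-p.2) * ((1 - Real.cos (p.1 * p.2)) / p.1 ^ 2))
      ((volume.restrict (Set.Ioi 0)).prod (volume.restrict (Set.Ioi 0))) := by
    rw [integrable_prod_iff (by
      refine Measurable.aestronglyMeasurable ?_
      fun_prop)]
    constructor
    · refine Eventually.of_forall fun r => ?_
      have : Integrable
          (fun t : ℝ => (r ^ 2)⁻¹ * (Real.exp (-t) - Real.exp (-t) * Real.cos (t * r)))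
          (volume.restrict (Set.Ioi 0)) :=
        ((integrableOn_exp_neg_Ioi 0).sub (integrableOn_exp_neg_mul_cos r)).const_mul _
      refine this.congr (Eventually.of_forall fun t => ?_)
      simp only
      rw [mul_comm t r]; ring
    · refine (integrable_inv_one_add_sq.restrict (s := Set.Ioi (0 : ℝ))).congr ?_
      filter_upwards [ae_restrict_mem measurableSet_Ioi] with r hr
      rw [← hinner r hr]
      refine integral_congr_ae (Eventually.of_forall fun t => ?_)
      simp only
      rw [Real.norm_eq_abs, abs_of_nonneg (hnn r t)]
  have h1 : ∫ t in Set.Ioi (0 : ℝ), Real.exp (-t) * (t * c) = c := by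
    have h2 : ∀ t : ℝ, Real.exp (-t) * (t * c) = c * (Real.exp (-t) * t) := fun t => by ring
    simp_rw [h2]
    rw [integral_const_mul]
    -- `Γ(2) = ∫_0^∞ e^{-t} t dt = 1`
    have h3 := Real.Gamma_eq_integral (s := 2) (by norm_num)
    norm_num at h3
    rw [← h3, mul_one]
  have h2 : ∫ t in Set.Ioi (0 : ℝ), Real.exp (-t) * (t * c)
      = ∫ t in Set.Ioi (0 : ℝ), ∫ r in Set.Ioi (0 : ℝ),
          Real.exp (-t) * ((1 - Real.cos (r * t)) / r ^ 2) := by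
    refine setIntegral_congr_fun measurableSet_Ioi fun t ht => ?_
    rw [integral_const_mul, integral_one_sub_cos_mul (le_of_lt ht)]
  have h3 : ∫ r in Set.Ioi (0 : ℝ), (1 + r ^ 2)⁻¹
      = ∫ r in Set.Ioi (0 : ℝ), ∫ t in Set.Ioi (0 : ℝ),
          Real.exp (-t) * ((1 - Real.cos (r * t)) / r ^ 2) :=
    setIntegral_congr_fun measurableSet_Ioi fun r hr => (hinner r hr).symm
  rw [← h1, h2, ← integral_integral_swap hprod, ← h3, integral_Ioi_inv_one_add_sq]
  simp

/-- On `[0, ∞)` the function `t` is, up to the constant `2 / π`, the sum of `t²` times a cosine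
transform and of another cosine transform. -/
lemma sq_mul_headSymbol_add_tailSymbol {t : ℝ} (ht : 0 ≤ t) :
    t ^ 2 * headSymbol t + tailSymbol t = Real.pi / 2 * t := by
  have hint : IntegrableOn (fun r : ℝ => (1 - Real.cos (r * t)) / r ^ 2) (Set.Ioi 0) := by
    rcases ht.eq_or_lt with rfl | ht
    · simp
    have h := (integrableOn_Ioi_comp_mul_right_iff (fun r => (1 - Real.cos r) / r ^ 2) 0 ht).2
      (by simpa using integrableOn_one_sub_cos)
    refine (h.const_mul (t ^ 2)).congr (Eventually.of_forall fun r => ?_)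
    simp only
    rw [mul_pow]
    field_simp
  have h1 : t ^ 2 * headSymbol t = ∫ r in Set.Ioc (0 : ℝ) 1, (1 - Real.cos (r * t)) / r ^ 2 := by
    rw [headSymbol, intervalIntegral.integral_of_le zero_le_one, ← integral_const_mul]
    refine setIntegral_congr_fun measurableSet_Ioc fun r hr => ?_
    have hr0 : r ≠ 0 := ne_of_gt hr.1
    rw [← sq_mul_meanSymbol]
    field_simp
  have h2 : tailSymbol t = ∫ r in Set.Ioi (1 : ℝ), (1 - Real.cos (r * t)) / r ^ 2 := by
    rw [tailSymbol]
    nth_rw 1 [← integral_inv_sq]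
    rw [← integral_sub integrableOn_inv_sq (integrableOn_inv_sq_mul_cos t)]
    refine setIntegral_congr_fun measurableSet_Ioi fun r _ => ?_
    ring
  rw [h1, h2, ← setIntegral_union (Set.Ioc_disjoint_Ioi le_rfl) measurableSet_Ioi
    (hint.mono_set Set.Ioc_subset_Ioi_self) (hint.mono_set (Set.Ioi_subset_Ioi zero_le_one)),
    Set.Ioc_union_Ioi_eq_Ioi (zero_le_one' ℝ), integral_one_sub_cos_mul ht, integral_one_sub_cos]
  ring

/-- The symbol of the resolvent `(1 + A)⁻¹`. -/
def resolventSymbol (t : ℝ) : ℝ := (1 + t ^ 2)⁻¹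

/-- `t / (1 + t²)` in terms of cosine transforms, using `t² / (1 + t²) = 1 - 1 / (1 + t²)`. -/
lemma resolventSymbol_mul_self {t : ℝ} (ht : 0 ≤ t) :
    resolventSymbol t * t = 2 / Real.pi * (headSymbol t - resolventSymbol t * headSymbol t
      + resolventSymbol t * tailSymbol t) := by
  have h := sq_mul_headSymbol_add_tailSymbol ht
  have hc : 2 / Real.pi * Real.pi = 2 := div_mul_cancel₀ _ Real.pi_ne_zero
  have he : resolventSymbol t * (1 + t ^ 2) = 1 := inv_mul_cancel₀ (by positivity)
  linear_combination (-(2 / Real.pi) * resolventSymbol t) * h - (resolventSymbol t * t / 2) * hc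
    + 2 / Real.pi * headSymbol t * he

end CosineCalculus

namespace CosineFunction

open CosineCalculus

/-! ### Some operators of the calculus -/

section Operators

variable {X : Type*} [NormedAddCommGroup X] [NormedSpace ℂ X]

/-- `∫_0^∞ e^{-r} Cos(r) x dr`, which is `(1 + A)⁻¹ x`. -/
def resolventOp (Cos : CosineFunction X) (x : X) : X :=
  ∫ r in Set.Ioi (0 : ℝ), Real.exp (-r) • Cos r x

/-- The operator with symbol `meanSymbol r`. -/
def meanOp (Cos : CosineFunction X) (r : ℝ) (x : X) : X :=
  ∫ v in (0 : ℝ)..1, (1 - v) • Cos (r * v) x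

/-- The operator with symbol `headSymbol`. -/
def headOp (Cos : CosineFunction X) (x : X) : X := ∫ r in (0 : ℝ)..1, Cos.meanOp r x

/-- The operator with symbol `tailSymbol`. -/
def tailOp (Cos : CosineFunction X) (x : X) : X :=
  x - ∫ r in Set.Ioi (1 : ℝ), (r ^ 2)⁻¹ • Cos r x

variable {Cos : CosineFunction X} {hCos : Cos.IsBounded}

lemma represents_integral_real {Ω : Type*} [MeasurableSpace Ω] {ρ : Measure Ω} {h σ : Ω → ℝ}
    (hh : Integrable h ρ) (hσ : Measurable σ) :
    Cos.Represents hCos (fun t : ℝ≥0 => ((∫ ω, h ω * Real.cos (σ ω * t) ∂ρ : ℝ) : ℂ))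
      (fun x => ∫ ω, h ω • Cos (σ ω) x ∂ρ) :=
  (represents_integral (Cos := Cos) (hCos := hCos) hh.ofReal hσ).congr
    (fun t => by
      rw [← integral_complex_ofReal]
      simp only [Complex.ofReal_mul, Complex.coe_algebraMap])
    (fun x => by simp only [Complex.coe_algebraMap, Complex.coe_smul])

lemma represents_intervalIntegral {a b : ℝ} {h σ : ℝ → ℝ} (hh : Continuous h)
    (hσ : Continuous σ) :
    Cos.Represents hCos
      (fun t : ℝ≥0 => ((∫ r in a..b, h r * Real.cos (σ r * t) : ℝ) : ℂ))
      (fun x => ∫ r in a..b, h r • Cos (σ r) x) := by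
  have hi := hh.intervalIntegrable (μ := volume) a b
  refine ((represents_integral_real (Cos := Cos) (hCos := hCos) hi.1 hσ.measurable).sub
    (represents_integral_real hi.2 hσ.measurable)).congr (fun t => ?_) (fun x => rfl)
  rw [intervalIntegral, Complex.ofReal_sub]

lemma represents_resolventOp :
    Cos.Represents hCos (fun t : ℝ≥0 => (resolventSymbol t : ℂ)) Cos.resolventOp :=
  (represents_integral_real (Cos := Cos) (hCos := hCos) (integrableOn_exp_neg_Ioi 0)
    measurable_id).congr
    (fun t => by simp only [id, integral_exp_neg_mul_cos, resolventSymbol]) (fun x => rfl)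

lemma represents_Sin (s : ℝ) :
    Cos.Represents hCos (fun t : ℝ≥0 => (sineSymbol s t : ℂ)) (Cos.Sin s) :=
  (represents_intervalIntegral (Cos := Cos) (hCos := hCos) (h := fun _ => 1) (σ := id)
    continuous_const continuous_id (a := 0) (b := s)).congr
    (fun t => by simp [sineSymbol]) (fun x => by simp [Sin])

lemma represents_meanOp (r : ℝ) :
    Cos.Represents hCos (fun t : ℝ≥0 => (meanSymbol r t : ℂ)) (Cos.meanOp r) :=
  represents_intervalIntegral (by fun_prop) (by fun_prop)

/-- The double integral that defines `headSymbol` is a single integral over `(0, 1]²`. -/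
lemma represents_headOp :
    Cos.Represents hCos (fun t : ℝ≥0 => (headSymbol t : ℂ)) Cos.headOp := by
  set ν : Measure ℝ := volume.restrict (Set.Ioc 0 1) with hν
  have hν' : IsFiniteMeasure ν := ⟨by simp [hν]⟩
  have hh : Integrable (fun p : ℝ × ℝ => 1 - p.2) (ν.prod ν) := by
    refine (integrable_const (1 : ℝ)).sub ?_
    have h2 : Integrable (fun v : ℝ => v) ν :=
      (continuous_id.integrableOn_Icc (a := 0) (b := 1)).mono_set Set.Ioc_subset_Icc_self
    exact h2.comp_snd ν
  have hσ : Measurable fun p : ℝ × ℝ => p.1 * p.2 := by fun_prop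
  refine (represents_integral_real (Cos := Cos) (hCos := hCos) hh hσ).congr
    (fun t => ?_) (fun x => ?_)
  · have hi : Integrable (fun p : ℝ × ℝ => (1 - p.2) * Real.cos (p.1 * p.2 * t)) (ν.prod ν) := by
      refine Integrable.mono' hh.norm (by fun_prop) (Eventually.of_forall fun p => ?_)
      rw [norm_mul]
      exact mul_le_of_le_one_right (norm_nonneg _) (Real.abs_cos_le_one _)
    rw [integral_prod _ hi, headSymbol, intervalIntegral.integral_of_le zero_le_one]
    simp only [meanSymbol, intervalIntegral.integral_of_le zero_le_one, ← hν]
  · have hi : Integrable (fun p : ℝ × ℝ => (1 - p.2) • Cos (p.1 * p.2) x) (ν.prod ν) := by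
      have := integrable_density_orbit hCos hh.ofReal hσ x
      simpa only [Complex.coe_algebraMap, Complex.coe_smul] using this
    rw [integral_prod _ hi, headOp, intervalIntegral.integral_of_le zero_le_one]
    simp only [meanOp, intervalIntegral.integral_of_le zero_le_one, ← hν]

lemma represents_tailOp [CompleteSpace X] :
    Cos.Represents hCos (fun t : ℝ≥0 => (tailSymbol t : ℂ)) Cos.tailOp :=
  (represents_one.sub (represents_integral_real (Cos := Cos) (hCos := hCos)
    integrableOn_inv_sq measurable_id)).congr
    (fun t => by simp [tailSymbol]) (fun x => rfl)

lemma norm_apply_le {M : ℝ} (hM : ∀ t, ‖Cos t‖ ≤ M) (s : ℝ) (x : X) : ‖Cos s x‖ ≤ M * ‖x‖ :=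
  (Cos s).le_of_opNorm_le (hM s) x

/-- A member of the primary calculus as a bounded operator. -/
def primaryCLM (Cos : CosineFunction X) (hCos : Cos.IsBounded) {f : ℝ≥0 → ℂ}
    (hf : f ∈ cosAlgebra) : X →L[ℂ] X :=
  ⟨Cos.primary hCos f, continuous_primary hf⟩

lemma Represents.exists_clm {f : ℝ≥0 → ℂ} {T : X → X} (hf : Cos.Represents hCos f T) :
    ∃ L : X →L[ℂ] X, ∀ x, L x = T x :=
  ⟨primaryCLM Cos hCos hf.1, hf.2⟩

end Operators

/-! ### Regularization by the resolvent -/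

section Generator

variable {X : Type*} [NormedAddCommGroup X] [NormedSpace ℂ X]
  {Cos : CosineFunction X} {hCos : Cos.IsBounded} {A : X →ₗ.[ℂ] X}

lemma growthBound_nonpos (hCos : Cos.IsBounded) : Cos.growthBound ≤ 0 := by
  obtain ⟨M, hM⟩ := hCos
  refine csInf_le ⟨0, fun ω hω => hω.1⟩ ⟨le_rfl, max M 1, le_max_right _ _, fun t => ?_⟩
  simpa using Or.inl (hM t)

/-- The resolvent of the generator at `l²` is the Laplace transform of the cosine function. -/
lemma exists_resolvent (hCos : Cos.IsBounded) (hA : Cos.IsGenerator (-A)) {l : ℝ} (hl : 0 < l) :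
    ∃ R : X →L[ℂ] X, IsResolventAt (-A) ((l : ℂ) ^ 2) R ∧
      ∀ x, l • R x = ∫ t in Set.Ioi (0 : ℝ), Real.exp (-l * t) • Cos t x := by
  obtain ⟨R, hR, h⟩ := hA l ((growthBound_nonpos hCos).trans_lt hl)
  exact ⟨R, hR, fun x => by simpa only [Complex.coe_smul] using h x⟩

/-- `(1 + A)⁻¹ (x + A x) = x`. -/
lemma resolventOp_add (hCos : Cos.IsBounded) (hA : Cos.IsGenerator (-A)) (x : A.domain) :
    Cos.resolventOp ((x : X) + A x) = x := by
  obtain ⟨R, hR, h⟩ := exists_resolvent hCos hA one_pos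
  have h2 := hR.2 x
  have h3 := h ((x : X) + A x)
  simp only [neg_mul, one_mul, one_smul] at h3
  rw [resolventOp, ← h3]
  rw [LinearPMap.neg_apply] at h2
  simpa using h2

lemma injective_resolventOp (hCos : Cos.IsBounded) (hA : Cos.IsGenerator (-A)) :
    Function.Injective (Cos.primary hCos fun t : ℝ≥0 => (resolventSymbol t : ℂ)) := by
  rw [injective_iff_map_eq_zero]
  intro x hx
  obtain ⟨R, hR, h⟩ := exists_resolvent hCos hA one_pos
  have h3 := h x
  simp only [neg_mul, one_mul, one_smul] at h3
  rw [represents_resolventOp.2, resolventOp, ← h3] at hx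
  obtain ⟨hd, h4⟩ := hR.1 x
  have h5 : (⟨R x, hd⟩ : (-A).domain) = 0 := Subtype.ext hx
  rw [← h4, h5, LinearPMap.map_zero, sub_zero, hx, smul_zero]

variable [CompleteSpace X]

lemma represents_resolvent_mul_id :
    Cos.Represents hCos (fun t : ℝ≥0 => (resolventSymbol t : ℂ) * ((t : ℝ) : ℂ))
      (fun x => (2 / Real.pi : ℂ) • (Cos.headOp x - Cos.resolventOp (Cos.headOp x)
        + Cos.resolventOp (Cos.tailOp x))) := by
  have hR := represents_resolventOp (Cos := Cos) (hCos := hCos)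
  refine (((represents_headOp.sub (hR.mul represents_headOp)).add
    (hR.mul represents_tailOp)).smul (2 / Real.pi : ℂ)).congr (fun t => ?_) (fun x => rfl)
  exact_mod_cast (resolventSymbol_mul_self t.2).symm

lemma isRegularizer_id (hCos : Cos.IsBounded) (hA : Cos.IsGenerator (-A)) :
    Cos.IsRegularizer hCos (fun t : ℝ≥0 => (resolventSymbol t : ℂ))
      (fun t => ((t : ℝ) : ℂ)) :=
  ⟨(represents_resolventOp (hCos := hCos)).1, (represents_resolvent_mul_id (hCos := hCos)).1,
    injective_resolventOp hCos hA⟩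

/-- The symbol of `S(s)`, regularized by the resolvent, factors through the one of `Sin(s)`. -/
lemma represents_resolvent_mul_sin (s : ℝ) :
    Cos.Represents hCos ((fun t : ℝ≥0 => (resolventSymbol t : ℂ))
        * fun t : ℝ≥0 => ((Real.sign t * Real.sin (s * t) : ℝ) : ℂ))
      (fun x => Cos.primary hCos ((fun t : ℝ≥0 => (resolventSymbol t : ℂ))
        * fun t : ℝ≥0 => ((t : ℝ) : ℂ)) (Cos.Sin s x)) := by
  have h0 := represents_primary (Cos := Cos) (hCos := hCos)
    (represents_resolvent_mul_id (Cos := Cos) (hCos := hCos)).1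
  refine (h0.mul (represents_Sin s)).congr (fun t => ?_) (fun x => rfl)
  have h : Real.sign t * Real.sin (s * t) = t * sineSymbol s t := by
    rw [mul_sineSymbol]
    rcases t.coe_nonneg.eq_or_lt with h | h
    · have : (t : ℝ) = 0 := h.symm
      simp [this]
    · rw [Real.sign_of_pos h, one_mul]
  simp only [Pi.mul_apply, h]
  push_cast
  ring

lemma isRegularizer_sin (hCos : Cos.IsBounded) (hA : Cos.IsGenerator (-A)) (s : ℝ) :
    Cos.IsRegularizer hCos (fun t : ℝ≥0 => (resolventSymbol t : ℂ))
      (fun t => ((Real.sign t * Real.sin (s * t) : ℝ) : ℂ)) :=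
  ⟨(represents_resolventOp (hCos := hCos)).1, (represents_resolvent_mul_sin (hCos := hCos) s).1,
    injective_resolventOp hCos hA⟩

/-- `S(s) = B Sin(s)`, with equality of domains. -/
lemma mem_graph_opS_iff (hCos : Cos.IsBounded) (hA : Cos.IsGenerator (-A)) (s : ℝ) (x y : X) :
    (x, y) ∈ (Cos.opS hCos s).graph ↔ (Cos.Sin s x, y) ∈ (Cos.opB hCos).graph := by
  rw [opS, opB, mem_graph_calculus_iff (isRegularizer_sin hCos hA s),
    mem_graph_calculus_iff (isRegularizer_id hCos hA),
    (represents_resolvent_mul_sin (hCos := hCos) s).2]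

/-- On the domain of `A`, `S(s)` is `2 / π` times `Sin(s)` applied to `headOp ∘ A + tailOp`. -/
lemma mem_graph_opS_of_mem_domain (hCos : Cos.IsBounded) (hA : Cos.IsGenerator (-A)) (s : ℝ)
    (x : A.domain) :
    ((x : X), (2 / Real.pi : ℂ) • Cos.Sin s (Cos.headOp (A x) + Cos.tailOp x))
      ∈ (Cos.opS hCos s).graph := by
  rw [mem_graph_opS_iff hCos hA, opB, mem_graph_calculus_iff (isRegularizer_id hCos hA)]
  have hR := represents_resolventOp (Cos := Cos) (hCos := hCos)
  have hJ := represents_headOp (Cos := Cos) (hCos := hCos)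
  have hQ := represents_tailOp (Cos := Cos) (hCos := hCos)
  have hS := represents_Sin (Cos := Cos) (hCos := hCos) s
  set z : X := (x : X) + A x with hz
  have hx : (x : X) = Cos.resolventOp z := (resolventOp_add hCos hA x).symm
  have hAx : A x = z - Cos.resolventOp z := by rw [← hx, hz]; abel
  have hT := represents_resolvent_mul_id (Cos := Cos) (hCos := hCos)
  have h1 := represents_one (Cos := Cos) (hCos := hCos)
  rw [map_smul, hR.2]
  refine Eq.trans ?_ (hT.2 _).symm
  rw [hAx, hx]
  refine ((hR.mul (hS.mul ((hJ.mul (h1.sub hR)).add (hQ.mul hR)))).smul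
    (2 / Real.pi : ℂ)).unique (hT.mul (hS.mul hR)) (fun t => ?_) z
  have h := congrArg (fun u : ℝ => (u : ℂ)) (resolventSymbol_mul_self t.2)
  change ((resolventSymbol (t : ℝ) * (t : ℝ) : ℝ) : ℂ) = ((2 / Real.pi * (headSymbol (t : ℝ)
    - resolventSymbol t * headSymbol t + resolventSymbol t * tailSymbol t) : ℝ) : ℂ) at h
  push_cast at h
  rw [h]
  ring

end Generator

/-! ### Truncated principal value integrals -/

section Truncated

variable {X : Type*} [NormedAddCommGroup X] [NormedSpace ℂ X]

/-- The principal value integral of the orbit of `x`, truncated to `a ≤ |r| ≤ b`. -/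
def truncated (Cos : CosineFunction X) (a b s : ℝ) (x : X) : X :=
  ∫ r in {r : ℝ | a ≤ |r| ∧ |r| ≤ b}, ((r : ℂ)⁻¹) • Cos (s - r) x

lemma setOf_abs_mem_eq {a : ℝ} (ha : 0 < a) (b : ℝ) :
    {r : ℝ | a ≤ |r| ∧ |r| ≤ b} = Set.Icc a b ∪ Set.Icc (-b) (-a) := by
  ext r
  simp only [Set.mem_ofPred_eq, Set.mem_union, Set.mem_Icc]
  rcases abs_cases r with ⟨h, h'⟩ | ⟨h, h'⟩ <;> rw [h] <;> constructor
  · exact fun h => Or.inl h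
  · rintro (h | h)
    · exact h
    · exact ⟨by linarith [h.1, h.2], by linarith [h.1, h.2]⟩
  · exact fun h => Or.inr ⟨by linarith [h.1, h.2], by linarith [h.1, h.2]⟩
  · rintro (h | h)
    · exact ⟨by linarith [h.1, h.2], by linarith [h.1, h.2]⟩
    · exact ⟨by linarith [h.1, h.2], by linarith [h.1, h.2]⟩

lemma setIntegral_abs_mem_eq {E : Type*} [NormedAddCommGroup E] [NormedSpace ℝ E] {a b : ℝ}
    (ha : 0 < a) (hab : a ≤ b) {f : ℝ → E} (hf : ContinuousOn f {0}ᶜ) :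
    ∫ r in {r : ℝ | a ≤ |r| ∧ |r| ≤ b}, f r = ∫ r in a..b, (f r + f (-r)) := by
  have hi1 : IntegrableOn f (Set.Icc a b) :=
    (hf.mono fun r hr => by
      simp only [Set.mem_compl_iff, Set.mem_singleton_iff]
      rintro rfl; linarith [hr.1]).integrableOn_compact isCompact_Icc
  have hi2 : IntegrableOn f (Set.Icc (-b) (-a)) :=
    (hf.mono fun r hr => by
      simp only [Set.mem_compl_iff, Set.mem_singleton_iff]
      rintro rfl; linarith [hr.2]).integrableOn_compact isCompact_Icc
  have hd : Disjoint (Set.Icc a b) (Set.Icc (-b) (-a)) := by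
    rw [Set.disjoint_left]
    intro r h1 h2
    linarith [h1.1, h2.2]
  have hI1 : IntervalIntegrable f volume a b :=
    (intervalIntegrable_iff_integrableOn_Icc_of_le hab).2 hi1
  have hI2 : IntervalIntegrable f volume (-b) (-a) :=
    (intervalIntegrable_iff_integrableOn_Icc_of_le (neg_le_neg hab)).2 hi2
  have hI3 : IntervalIntegrable (fun r => f (-r)) volume a b := by
    refine ContinuousOn.intervalIntegrable (hf.comp continuous_neg.continuousOn fun r hr => ?_)
    rw [Set.uIcc_of_le hab] at hr
    simpa using (ha.trans_le hr.1).ne'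
  rw [setOf_abs_mem_eq ha, setIntegral_union hd measurableSet_Icc hi1 hi2,
    intervalIntegral.integral_add hI1 hI3, intervalIntegral.integral_comp_neg,
    intervalIntegral.integral_of_le hab, intervalIntegral.integral_of_le (neg_le_neg hab),
    integral_Icc_eq_integral_Ioc, integral_Icc_eq_integral_Ioc]

variable {Cos : CosineFunction X} {hCos : Cos.IsBounded}

lemma continuousOn_inv_smul_orbit (s : ℝ) (x : X) :
    ContinuousOn (fun r : ℝ => ((r : ℂ)⁻¹) • Cos (s - r) x) {0}ᶜ := by
  refine ContinuousOn.smul (ContinuousOn.inv₀ (by fun_prop) fun r hr => ?_)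
    ((Cos.strongly_continuous x).comp (by fun_prop)).continuousOn
  exact Complex.ofReal_ne_zero.2 hr

lemma truncated_eq_intervalIntegral {a b : ℝ} (ha : 0 < a) (hab : a ≤ b) (s : ℝ) (x : X) :
    Cos.truncated a b s x = ∫ r in a..b, r⁻¹ • (Cos (s - r) x - Cos (s + r) x) := by
  rw [truncated, setIntegral_abs_mem_eq ha hab (continuousOn_inv_smul_orbit s x)]
  refine intervalIntegral.integral_congr fun r _ => ?_
  simp only [sub_neg_eq_add, smul_sub, ← Complex.coe_smul]
  push_cast
  rw [inv_neg, neg_smul]; abel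

lemma continuousOn_inv_smul_sub {a b : ℝ} (ha : 0 < a) (hab : a ≤ b) (s : ℝ) (x : X) :
    ContinuousOn (fun r : ℝ => r⁻¹ • (Cos (s - r) x - Cos (s + r) x)) (Set.uIcc a b) := by
  have hinv : ContinuousOn (fun r : ℝ => r⁻¹) (Set.uIcc a b) :=
    continuousOn_inv₀.mono fun r hr => by
      rw [Set.uIcc_of_le hab] at hr
      exact (ha.trans_le hr.1).ne'
  exact hinv.smul (((Cos.strongly_continuous x).comp (by fun_prop)).sub
    ((Cos.strongly_continuous x).comp (by fun_prop))).continuousOn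

lemma truncated_sub {a b : ℝ} (ha : 0 < a) (hab : a ≤ b) (s : ℝ) (x y : X) :
    Cos.truncated a b s (x - y) = Cos.truncated a b s x - Cos.truncated a b s y := by
  simp only [truncated_eq_intervalIntegral ha hab]
  rw [← intervalIntegral.integral_sub (continuousOn_inv_smul_sub ha hab s x).intervalIntegrable
    (continuousOn_inv_smul_sub ha hab s y).intervalIntegrable]
  refine intervalIntegral.integral_congr fun r _ => ?_
  simp only [map_sub]
  module

variable [CompleteSpace X]

/-- The addition formula for sine, read off from `t sineSymbol s t = sin (s t)`. -/
lemma Sin_add_add_Sin_sub (hCos : Cos.IsBounded) (s r : ℝ) (x : X) :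
    Cos.Sin (s + r) x + Cos.Sin (s - r) x = (2 : ℂ) • Cos.Sin s (Cos r x) := by
  refine ((represents_Sin (hCos := hCos) (s + r)).add (represents_Sin (s - r))).unique
    (((represents_Sin s).mul (represents_cos r)).smul 2) (fun t => ?_) x
  have h : sineSymbol (s + r) t + sineSymbol (s - r) t
      = 2 * (sineSymbol s t * Real.cos (r * t)) := by
    rcases eq_or_ne (t : ℝ) 0 with h | h
    · simp [h, sineSymbol]; ring
    · refine mul_left_cancel₀ h ?_
      have e : (t : ℝ) * (2 * (sineSymbol s t * Real.cos (r * t)))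
        = 2 * ((t * sineSymbol s t) * Real.cos (r * t)) := by ring
      rw [e, mul_add, mul_sineSymbol, mul_sineSymbol, mul_sineSymbol, add_mul, sub_mul,
        Real.sin_add, Real.sin_sub]
      ring
  exact_mod_cast h

lemma hasDerivAt_Sin (s : ℝ) (x : X) : HasDerivAt (fun s => Cos.Sin s x) (Cos s x) s :=
  (Cos.strongly_continuous x).integral_hasStrictDerivAt 0 s |>.hasDerivAt

/-- Integration by parts, since `2 Sin(s) (x - Cos(r) x)` is a primitive in `r` of
`Cos(s - r) x - Cos(s + r) x`. -/
lemma truncated_eq (hCos : Cos.IsBounded) {a b : ℝ} (ha : 0 < a) (hab : a ≤ b) (s : ℝ) (x : X) :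
    Cos.truncated a b s x = (2 : ℂ) • Cos.Sin s (b⁻¹ • (x - Cos b x) - a⁻¹ • (x - Cos a x)
      + ∫ r in a..b, (r ^ 2)⁻¹ • (x - Cos r x)) := by
  obtain ⟨L, hL⟩ := (represents_Sin (Cos := Cos) (hCos := hCos) s).exists_clm
  have hne : ∀ r ∈ Set.uIcc a b, r ≠ 0 := by
    intro r hr
    rw [Set.uIcc_of_le hab] at hr
    exact (ha.trans_le hr.1).ne'
  have hF : ∀ r, HasDerivAt (fun r => (2 : ℂ) • Cos.Sin s (x - Cos r x))
      (Cos (s - r) x - Cos (s + r) x) r := by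
    intro r
    have h1 : HasDerivAt (fun r => Cos.Sin (s + r) x) (Cos (s + r) x) r := by
      refine ((hasDerivAt_Sin (Cos := Cos) (s + r) x).scomp r
        ((hasDerivAt_id r).const_add s)).congr_deriv ?_
      simp
    have h2 : HasDerivAt (fun r => Cos.Sin (s - r) x) (-Cos (s - r) x) r := by
      refine ((hasDerivAt_Sin (Cos := Cos) (s - r) x).scomp r
        ((hasDerivAt_id r).const_sub s)).congr_deriv ?_
      simp
    have h3 := (h1.add h2).const_sub ((2 : ℂ) • Cos.Sin s x)
    refine (h3.congr_deriv (by abel)).congr_of_eventuallyEq (Eventually.of_forall fun r => ?_)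
    simp only [Pi.add_apply]
    rw [Sin_add_add_Sin_sub hCos, ← smul_sub, ← hL, ← hL, ← hL, map_sub]
  have hG : ∀ r ∈ Set.uIcc a b, HasDerivAt (fun r => r⁻¹ • (2 : ℂ) • Cos.Sin s (x - Cos r x))
      (r⁻¹ • (Cos (s - r) x - Cos (s + r) x)
        + (-(r ^ 2)⁻¹) • (2 : ℂ) • Cos.Sin s (x - Cos r x)) r := fun r hr =>
    (hasDerivAt_inv (hne r hr)).smul (hF r)
  have hinv2 : ContinuousOn (fun r : ℝ => (r ^ 2)⁻¹) (Set.uIcc a b) :=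
    ContinuousOn.inv₀ (by fun_prop) fun r hr => pow_ne_zero 2 (hne r hr)
  have hc1 := continuousOn_inv_smul_sub (Cos := Cos) ha hab s x
  have hc3 : ContinuousOn (fun r => (r ^ 2)⁻¹ • (x - Cos r x)) (Set.uIcc a b) :=
    hinv2.smul (continuous_const.sub (Cos.strongly_continuous x)).continuousOn
  have hc2 : ContinuousOn (fun r => (-(r ^ 2)⁻¹) • (2 : ℂ) • Cos.Sin s (x - Cos r x))
      (Set.uIcc a b) := by
    refine hinv2.neg.smul ?_
    exact (continuous_iff_continuousAt.2 fun r => (hF r).continuousAt).continuousOn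
  have h := intervalIntegral.integral_eq_sub_of_hasDerivAt hG
    (hc1.add hc2).intervalIntegrable
  rw [intervalIntegral.integral_add hc1.intervalIntegrable hc2.intervalIntegrable,
    ← truncated_eq_intervalIntegral ha hab] at h
  have h4 : ∫ r in a..b, (-(r ^ 2)⁻¹) • (2 : ℂ) • Cos.Sin s (x - Cos r x)
      = - ((2 : ℂ) • L (∫ r in a..b, (r ^ 2)⁻¹ • (x - Cos r x))) := by
    rw [← L.intervalIntegral_comp_comm hc3.intervalIntegrable, ← intervalIntegral.integral_smul,
      ← intervalIntegral.integral_neg]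
    refine intervalIntegral.integral_congr fun r _ => ?_
    simp only [neg_smul, ← hL, ← Complex.coe_smul, map_smul]
    rw [smul_comm]
  rw [h4] at h
  rw [← hL, map_add, smul_add, ← sub_eq_iff_eq_add, sub_eq_add_neg, h]
  simp only [← hL, map_sub, smul_sub, L.map_smul_of_tower, smul_comm (2 : ℂ)]

end Truncated

section Limit

variable {X : Type*} [NormedAddCommGroup X] [NormedSpace ℂ X] [CompleteSpace X]
  {Cos : CosineFunction X} {hCos : Cos.IsBounded} {A : X →ₗ.[ℂ] X}

/-- `x - Cos(r) x = O(r²)` on the domain of `A`: the operator version of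
`1 - cos (r t) = (r t)² meanSymbol r t`. -/
lemma sub_cos_eq (hCos : Cos.IsBounded) (hA : Cos.IsGenerator (-A)) (x : A.domain) (r : ℝ) :
    (x : X) - Cos r x = (r ^ 2) • Cos.meanOp r (A x) := by
  have hR := represents_resolventOp (Cos := Cos) (hCos := hCos)
  have h1 := represents_one (Cos := Cos) (hCos := hCos)
  set z : X := (x : X) + A x with hz
  have hx : (x : X) = Cos.resolventOp z := (resolventOp_add hCos hA x).symm
  have hAx : A x = z - Cos.resolventOp z := by rw [← hx, hz]; abel
  rw [hAx, hx, ← Complex.coe_smul]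
  refine ((h1.sub (represents_cos r)).mul hR).unique
    (((represents_meanOp r).mul (h1.sub hR)).smul ((r ^ 2 : ℝ) : ℂ)) (fun t => ?_) z
  have h : (1 - Real.cos (r * t)) * resolventSymbol t
      = r ^ 2 * (meanSymbol r t * (1 - resolventSymbol t)) := by
    rw [← sq_mul_meanSymbol]
    have he : resolventSymbol t * (1 + (t : ℝ) ^ 2) = 1 := inv_mul_cancel₀ (by positivity)
    linear_combination r ^ 2 * meanSymbol r t * he
  exact_mod_cast h

lemma continuous_meanOp {X : Type*} [NormedAddCommGroup X] [NormedSpace ℂ X]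
    {Cos : CosineFunction X} (x : X) : Continuous fun r => Cos.meanOp r x := by
  refine intervalIntegral.continuous_parametric_intervalIntegral_of_continuous' ?_ 0 1
  have h : Continuous fun p : ℝ × ℝ => 1 - p.2 := by fun_prop
  exact h.smul ((Cos.strongly_continuous x).comp (by fun_prop))

/-- The integral `∫_0^∞ (x - Cos(r) x) / r² dr` converges absolutely for `x ∈ D(A)`. -/
lemma integrableOn_and_integral_sub_cos (hCos : Cos.IsBounded) (hA : Cos.IsGenerator (-A))
    (x : A.domain) :
    IntegrableOn (fun r : ℝ => (r ^ 2)⁻¹ • ((x : X) - Cos r x)) (Set.Ioi 0) ∧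
      ∫ r in Set.Ioi (0 : ℝ), (r ^ 2)⁻¹ • ((x : X) - Cos r x)
        = Cos.headOp (A x) + Cos.tailOp x := by
  have h1 : Set.EqOn (fun r : ℝ => Cos.meanOp r (A x))
      (fun r : ℝ => (r ^ 2)⁻¹ • ((x : X) - Cos r x)) (Set.Ioc 0 1) := by
    intro r hr
    simp only
    rw [sub_cos_eq hCos hA, smul_smul, inv_mul_cancel₀ (pow_ne_zero 2 hr.1.ne'), one_smul]
  have hi1 : IntegrableOn (fun r : ℝ => Cos.meanOp r (A x)) (Set.Ioc 0 1) :=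
    ((continuous_meanOp (Cos := Cos) (A x)).integrableOn_Icc).mono_set Set.Ioc_subset_Icc_self
  have hi2 : IntegrableOn (fun r : ℝ => (r ^ 2)⁻¹ • (x : X)) (Set.Ioi 1) :=
    integrableOn_inv_sq.smul_const _
  have hi3 : IntegrableOn (fun r : ℝ => (r ^ 2)⁻¹ • Cos r x) (Set.Ioi 1) := by
    have := integrable_density_orbit hCos integrableOn_inv_sq.ofReal measurable_id (x : X)
    simpa only [Complex.coe_algebraMap, Complex.coe_smul, id, IntegrableOn] using this
  have hi4 : IntegrableOn (fun r : ℝ => (r ^ 2)⁻¹ • ((x : X) - Cos r x)) (Set.Ioi 1) := by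
    simp only [smul_sub]; exact hi2.sub hi3
  have hi5 := hi1.congr_fun h1 measurableSet_Ioc
  rw [← Set.Ioc_union_Ioi_eq_Ioi (zero_le_one' ℝ)]
  refine ⟨hi5.union hi4, ?_⟩
  rw [setIntegral_union (Set.Ioc_disjoint_Ioi le_rfl) measurableSet_Ioi hi5 hi4,
    ← setIntegral_congr_fun measurableSet_Ioc h1, headOp, tailOp,
    intervalIntegral.integral_of_le zero_le_one]
  simp only [smul_sub]
  rw [integral_sub hi2 hi3, integral_smul_const, integral_inv_sq, one_smul]

lemma tendsto_truncated_of_mem_domain (hCos : Cos.IsBounded) (hA : Cos.IsGenerator (-A)) (s : ℝ)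
    (x : A.domain) :
    HasPrincipalValue (fun r : ℝ => ((r : ℂ)⁻¹) • Cos (s - r) x)
      ((2 : ℂ) • Cos.Sin s (Cos.headOp (A x) + Cos.tailOp x)) := by
  obtain ⟨M, hM⟩ := id hCos
  obtain ⟨L, hL⟩ := (represents_Sin (Cos := Cos) (hCos := hCos) s).exists_clm
  obtain ⟨hi, hv⟩ := integrableOn_and_integral_sub_cos hCos hA x
  have hfst : Tendsto (fun p : ℝ × ℝ => p.1) (𝓝[>] (0 : ℝ) ×ˢ atTop) (𝓝[>] (0 : ℝ)) := tendsto_fst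
  have hsnd : Tendsto (fun p : ℝ × ℝ => p.2) (𝓝[>] (0 : ℝ) ×ˢ atTop) atTop := tendsto_snd
  have hev : ∀ᶠ p : ℝ × ℝ in 𝓝[>] (0 : ℝ) ×ˢ atTop, 0 < p.1 ∧ p.1 ≤ 1 ∧ 1 ≤ p.2 := by
    filter_upwards [hfst.eventually self_mem_nhdsWithin,
      hfst.eventually (mem_nhdsWithin_of_mem_nhds (Iic_mem_nhds zero_lt_one)),
      hsnd.eventually (eventually_ge_atTop 1)] with p h1 h2 h3
    exact ⟨h1, h2, h3⟩
  have hcover : AECover (volume.restrict (Set.Ioi (0 : ℝ))) (𝓝[>] (0 : ℝ) ×ˢ atTop)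
      (fun p : ℝ × ℝ => Set.Ioc p.1 p.2) := by
    have h1 := aecover_Ioi_of_Ioi (μ := (volume : Measure ℝ)) (A := (0 : ℝ))
      (hfst.mono_right nhdsWithin_le_nhds)
    have h2 := (aecover_Iic (μ := (volume : Measure ℝ)) hsnd).restrict (s := Set.Ioi (0 : ℝ))
    exact h1.inter h2
  have hI : Tendsto (fun p : ℝ × ℝ => ∫ r in p.1..p.2, (r ^ 2)⁻¹ • ((x : X) - Cos r x))
      (𝓝[>] (0 : ℝ) ×ˢ atTop) (𝓝 (Cos.headOp (A x) + Cos.tailOp x)) := by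
    rw [← hv]
    refine (hcover.integral_tendsto_of_countably_generated hi).congr' ?_
    filter_upwards [hev] with p hp
    rw [intervalIntegral.integral_of_le (hp.2.1.trans hp.2.2),
      Measure.restrict_restrict measurableSet_Ioc,
      Set.inter_eq_left.2 (Set.Ioc_subset_Ioi_self.trans (Set.Ioi_subset_Ioi hp.1.le))]
  have hb : Tendsto (fun p : ℝ × ℝ => p.2⁻¹ • ((x : X) - Cos p.2 x))
      (𝓝[>] (0 : ℝ) ×ˢ atTop) (𝓝 0) := by
    have h0 : Tendsto (fun p : ℝ × ℝ => p.2⁻¹ * (‖(x : X)‖ + M * ‖(x : X)‖))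
        (𝓝[>] (0 : ℝ) ×ˢ atTop) (𝓝 0) := by
      simpa using (tendsto_inv_atTop_zero.comp hsnd).mul_const (‖(x : X)‖ + M * ‖(x : X)‖)
    refine squeeze_zero_norm' ?_ h0
    filter_upwards [hev] with p hp
    have hp2 : 0 ≤ p.2⁻¹ := inv_nonneg.2 (zero_le_one.trans hp.2.2)
    rw [norm_smul, Real.norm_of_nonneg hp2]
    exact mul_le_mul_of_nonneg_left ((norm_sub_le _ _).trans
      (add_le_add le_rfl (norm_apply_le hM _ _))) hp2
  have ha : Tendsto (fun p : ℝ × ℝ => p.1⁻¹ • ((x : X) - Cos p.1 x))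
      (𝓝[>] (0 : ℝ) ×ˢ atTop) (𝓝 0) := by
    have h1 : Tendsto (fun r : ℝ => r • Cos.meanOp r (A x)) (𝓝 0) (𝓝 0) := by
      have : Continuous fun r : ℝ => r • Cos.meanOp r (A x) :=
        continuous_id.smul (continuous_meanOp (A x))
      simpa using this.tendsto 0
    refine ((h1.mono_left nhdsWithin_le_nhds).comp hfst).congr' ?_
    filter_upwards [hev] with p hp
    have : p.1 ≠ 0 := hp.1.ne'
    simp only [Function.comp_apply]
    rw [sub_cos_eq hCos hA, smul_smul]
    congr 1
    field_simp
  have h := (L.continuous.tendsto _).comp ((hb.sub ha).add hI)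
  rw [sub_zero, zero_add] at h
  have h2 := h.const_smul (2 : ℂ)
  rw [hL] at h2
  refine h2.congr' ?_
  filter_upwards [hev] with p hp
  simp only [Function.comp_apply]
  rw [hL]
  exact (truncated_eq hCos hp.1 (hp.2.1.trans hp.2.2) s x).symm

lemma exists_principalValue_of_mem_domain (hCos : Cos.IsBounded) (hA : Cos.IsGenerator (-A))
    (s : ℝ) {x : X} (hx : x ∈ A.domain) :
    ∃ l : X, HasPrincipalValue (fun r : ℝ => ((r : ℂ)⁻¹) • Cos (s - r) x) l ∧
      (x, ((Real.pi : ℂ)⁻¹) • l) ∈ (Cos.opS hCos s).graph := by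
  refine ⟨_, tendsto_truncated_of_mem_domain hCos hA s ⟨x, hx⟩, ?_⟩
  rw [smul_smul, inv_mul_eq_div]
  exact mem_graph_opS_of_mem_domain hCos hA s ⟨x, hx⟩

end Limit

end CosineFunction

namespace CosineCalculus

/-! ### Young's inequality on `L²(ℝ)` -/

/-- Convolution with an integrable kernel on `L²`, for functions with values in `[0, ∞]`. -/
lemma eLpNorm_two_lconvolution_le {K F : ℝ → ℝ≥0∞} (hK : Measurable K) (hF : Measurable F) :
    eLpNorm (fun x => ∫⁻ y, K y * F (x - y)) 2 ≤ (∫⁻ y, K y) * eLpNorm F 2 := by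
  rw [eLpNorm_eq_lintegral_rpow_enorm_toReal two_ne_zero ENNReal.ofNat_ne_top,
    eLpNorm_eq_lintegral_rpow_enorm_toReal two_ne_zero ENNReal.ofNat_ne_top]
  simp only [ENNReal.toReal_ofNat, enorm_eq_self]
  set κ := ∫⁻ y, K y with hκ
  have hhalf : ∀ c : ℝ≥0∞, (c ^ (1 / 2 : ℝ)) ^ (2 : ℝ) = c := fun c => by
    rw [← ENNReal.rpow_mul]; norm_num
  have hhalf' : ∀ c : ℝ≥0∞, (c ^ (2 : ℝ)) ^ (1 / 2 : ℝ) = c := fun c => by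
    rw [← ENNReal.rpow_mul]; norm_num
  -- Cauchy–Schwarz for `K F = K^{1/2} · K^{1/2} F`
  have hcs : ∀ x, (∫⁻ y, K y * F (x - y)) ^ (2 : ℝ) ≤ κ * ∫⁻ y, K y * F (x - y) ^ (2 : ℝ) := by
    intro x
    have h := ENNReal.lintegral_mul_le_Lp_mul_Lq (volume : Measure ℝ) Real.HolderConjugate.two_two
      (f := fun y => K y ^ (1 / 2 : ℝ)) (g := fun y => K y ^ (1 / 2 : ℝ) * F (x - y))
      (hK.pow_const _).aemeasurable
      ((hK.pow_const _).mul (hF.comp (by fun_prop))).aemeasurable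
    have e1 : ∀ y, ((fun y => K y ^ (1 / 2 : ℝ)) * fun y => K y ^ (1 / 2 : ℝ) * F (x - y)) y
        = K y * F (x - y) := by
      intro y
      simp only [Pi.mul_apply]
      rw [← mul_assoc, ← ENNReal.rpow_add_of_nonneg _ _ (by norm_num) (by norm_num)]
      norm_num
    simp only [e1, hhalf, ENNReal.mul_rpow_of_nonneg _ _ zero_le_two] at h
    calc (∫⁻ y, K y * F (x - y)) ^ (2 : ℝ)
        ≤ (κ ^ (1 / 2 : ℝ) * (∫⁻ y, K y * F (x - y) ^ (2 : ℝ)) ^ (1 / 2 : ℝ)) ^ (2 : ℝ) :=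
          ENNReal.rpow_le_rpow h zero_le_two
      _ = _ := by rw [ENNReal.mul_rpow_of_nonneg _ _ zero_le_two, hhalf, hhalf]
  have hswap : ∫⁻ x, ∫⁻ y, K y * F (x - y) ^ (2 : ℝ) = κ * ∫⁻ x, F x ^ (2 : ℝ) := by
    rw [lintegral_lintegral_swap (by
      refine Measurable.aemeasurable ?_
      exact (hK.comp measurable_snd).mul ((hF.comp (by fun_prop)).pow_const _))]
    have : ∀ y, ∫⁻ x, K y * F (x - y) ^ (2 : ℝ) = K y * ∫⁻ x, F x ^ (2 : ℝ) := by
      intro y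
      have hm : Measurable fun x => F (x - y) ^ (2 : ℝ) :=
        (hF.comp (measurable_id.sub_const y)).pow_const _
      rw [lintegral_const_mul _ hm,
        lintegral_sub_right_eq_self (fun x => F x ^ (2 : ℝ)) y]
    simp_rw [this]
    rw [lintegral_mul_const _ hK]
  calc (∫⁻ x, (∫⁻ y, K y * F (x - y)) ^ (2 : ℝ)) ^ (1 / 2 : ℝ)
      ≤ (∫⁻ x, κ * ∫⁻ y, K y * F (x - y) ^ (2 : ℝ)) ^ (1 / 2 : ℝ) :=
        ENNReal.rpow_le_rpow (lintegral_mono hcs) (by norm_num)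
    _ = (κ ^ (2 : ℝ) * ∫⁻ x, F x ^ (2 : ℝ)) ^ (1 / 2 : ℝ) := by
        rw [lintegral_const_mul _ (by
          refine Measurable.lintegral_prod_right'
            (f := fun p : ℝ × ℝ => K p.2 * F (p.1 - p.2) ^ (2 : ℝ)) ?_
          exact (hK.comp measurable_snd).mul ((hF.comp (by fun_prop)).pow_const _)), hswap,
          ← mul_assoc]
        congr 2
        rw [ENNReal.rpow_two, sq]
    _ = κ * (∫⁻ x, F x ^ (2 : ℝ)) ^ (1 / 2 : ℝ) := by
        rw [ENNReal.mul_rpow_of_nonneg _ _ (by norm_num), hhalf']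

/-! ### Poisson and conjugate Poisson kernels -/

lemma sub_mul_I_ne_zero {a : ℝ} (ha : 0 < a) (x : ℝ) :
    (a - x * Complex.I : ℂ) ≠ 0 ∧ (a + x * Complex.I : ℂ) ≠ 0
      ∧ ((a : ℂ) ^ 2 + (x : ℂ) ^ 2) ≠ 0 ∧ ((a : ℂ) ^ 2 + (x : ℂ) ^ 2)
        = (a - x * Complex.I) * (a + x * Complex.I) := by
  have h1 : (a - x * Complex.I : ℂ) ≠ 0 := by
    intro h; have := congrArg Complex.re h; simp at this; exact ha.ne' this
  have h2 : (a + x * Complex.I : ℂ) ≠ 0 := by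
    intro h; have := congrArg Complex.re h; simp at this; exact ha.ne' this
  have h3 : ((a : ℂ) ^ 2 + (x : ℂ) ^ 2) = (a - x * Complex.I) * (a + x * Complex.I) := by
    linear_combination ((x : ℂ) ^ 2) * Complex.I_sq
  exact ⟨h1, h2, h3 ▸ mul_ne_zero h1 h2, h3⟩

/-- The Fourier transform of `e^{-2π a |ξ|}` times a function which equals `c` on the positive and
`d` on the negative half-line. -/
lemma integral_exp_neg_abs_mul {a : ℝ} (ha : 0 < a) (x : ℝ) (c d : ℂ) (K : ℝ → ℂ)
    (hp : ∀ ξ, 0 < ξ → K ξ = c) (hn : ∀ ξ, ξ < 0 → K ξ = d) :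
    ∫ ξ : ℝ, Complex.exp (((2 * Real.pi * (x * ξ) : ℝ) : ℂ) * Complex.I)
        * (K ξ * (Real.exp (-(2 * Real.pi * a * |ξ|)) : ℂ))
      = (c / (a - x * Complex.I) + d / (a + x * Complex.I)) / (2 * Real.pi) := by
  have hpi := Real.pi_pos
  have hw : (-(2 * Real.pi * (a - x * Complex.I)) : ℂ).re < 0 := by
    simp; positivity
  have hw' : 0 < (2 * Real.pi * (a + x * Complex.I) : ℂ).re := by
    simp; positivity
  set f : ℝ → ℂ := fun ξ => Complex.exp (((2 * Real.pi * (x * ξ) : ℝ) : ℂ) * Complex.I)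
        * (K ξ * (Real.exp (-(2 * Real.pi * a * |ξ|)) : ℂ))
  have e1 : Set.EqOn (fun ξ : ℝ => c * Complex.exp (-(2 * Real.pi * (a - x * Complex.I)) * ξ)) f
      (Set.Ioi 0) := by
    intro ξ hξ
    have hξ' : 0 < ξ := hξ
    simp only [f]
    rw [hp ξ hξ, abs_of_pos hξ', mul_left_comm, Complex.ofReal_exp, ← Complex.exp_add]
    congr 2
    push_cast
    ring
  have e2 : Set.EqOn (fun ξ : ℝ => d * Complex.exp (2 * Real.pi * (a + x * Complex.I) * ξ)) f
      (Set.Iio 0) := by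
    intro ξ hξ
    have hξ' : ξ < 0 := hξ
    simp only [f]
    rw [hn ξ hξ, abs_of_neg hξ', mul_left_comm, Complex.ofReal_exp, ← Complex.exp_add]
    congr 2
    push_cast
    ring
  have i1 : IntegrableOn f (Set.Ioi 0) :=
    IntegrableOn.congr_fun ((integrableOn_exp_mul_complex_Ioi hw 0).const_mul c) e1
      measurableSet_Ioi
  have i2 : IntegrableOn f (Set.Iio 0) :=
    IntegrableOn.congr_fun (((integrableOn_exp_mul_complex_Iic hw' 0).mono_set
      Set.Iio_subset_Iic_self).const_mul d) e2 measurableSet_Iio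
  have i3 : IntegrableOn f (Set.Iic 0) := by
    rw [integrableOn_Iic_iff_integrableOn_Iio]; exact i2
  have v1 : ∫ ξ in Set.Ioi 0, f ξ = c * (1 / (2 * Real.pi * (a - x * Complex.I))) := by
    rw [← setIntegral_congr_fun measurableSet_Ioi e1, integral_const_mul,
      integral_exp_mul_complex_Ioi hw]
    simp
  have v2 : ∫ ξ in Set.Iic 0, f ξ = d * (1 / (2 * Real.pi * (a + x * Complex.I))) := by
    rw [integral_Iic_eq_integral_Iio, ← setIntegral_congr_fun measurableSet_Iio e2,
      ← integral_Iic_eq_integral_Iio, integral_const_mul, integral_exp_mul_complex_Iic hw']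
    simp
  rw [← intervalIntegral.integral_Iic_add_Ioi i3 i1, v1, v2]
  obtain ⟨h1, h2, -, -⟩ := sub_mul_I_ne_zero ha x
  have h3 : (Real.pi : ℂ) ≠ 0 := by exact_mod_cast Real.pi_ne_zero
  field_simp
  ring

/-- The Poisson kernel, without the factor `1 / π`. -/
def poisson (a y : ℝ) : ℝ := a / (a ^ 2 + y ^ 2)

/-- The conjugate Poisson kernel, without the factor `1 / π`. -/
def conjPoisson (a y : ℝ) : ℝ := y / (a ^ 2 + y ^ 2)

lemma sq_add_sq_pos {a : ℝ} (ha : 0 < a) (y : ℝ) : 0 < a ^ 2 + y ^ 2 := by positivity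

lemma integral_exp_neg_abs {a : ℝ} (ha : 0 < a) (x : ℝ) :
    ∫ ξ : ℝ, Complex.exp (((2 * Real.pi * (x * ξ) : ℝ) : ℂ) * Complex.I)
        * (Real.exp (-(2 * Real.pi * a * |ξ|)) : ℂ)
      = (Real.pi : ℂ)⁻¹ * poisson a x := by
  have h := integral_exp_neg_abs_mul ha x 1 1 (fun _ => 1) (fun _ _ => rfl) (fun _ _ => rfl)
  simp only [one_mul] at h
  rw [h]
  obtain ⟨h1, h2, h4, h5⟩ := sub_mul_I_ne_zero ha x
  have h3 : (Real.pi : ℂ) ≠ 0 := by exact_mod_cast Real.pi_ne_zero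
  rw [poisson]
  push_cast
  rw [h5]
  field_simp
  ring

lemma integral_sign_mul_exp_neg_abs {a : ℝ} (ha : 0 < a) (x : ℝ) :
    ∫ ξ : ℝ, Complex.exp (((2 * Real.pi * (x * ξ) : ℝ) : ℂ) * Complex.I)
        * (-Complex.I * ((Real.sign (2 * Real.pi * ξ) : ℝ) : ℂ)
          * (Real.exp (-(2 * Real.pi * a * |ξ|)) : ℂ))
      = (Real.pi : ℂ)⁻¹ * conjPoisson a x := by
  have h := integral_exp_neg_abs_mul ha x (-Complex.I) Complex.I
    (fun ξ => -Complex.I * ((Real.sign (2 * Real.pi * ξ) : ℝ) : ℂ))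
    (fun ξ hξ => by
      rw [Real.sign_of_pos (by have := Real.pi_pos; positivity)]; simp)
    (fun ξ hξ => by
      rw [Real.sign_of_neg (mul_neg_of_pos_of_neg (by have := Real.pi_pos; positivity) hξ)]; simp)
  rw [h]
  obtain ⟨h1, h2, h4, h5⟩ := sub_mul_I_ne_zero ha x
  have h3 : (Real.pi : ℂ) ≠ 0 := by exact_mod_cast Real.pi_ne_zero
  rw [conjPoisson]
  push_cast
  rw [h5]
  have h6 : (a + x * Complex.I : ℂ) - (a - x * Complex.I) = 2 * x * Complex.I := by ring
  generalize (a - x * Complex.I : ℂ) = u at *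
  generalize (a + x * Complex.I : ℂ) = v at *
  field_simp
  linear_combination (-Complex.I) * h6 - 2 * (x : ℂ) * Complex.I_sq

lemma poisson_nonneg {a : ℝ} (ha : 0 < a) (y : ℝ) : 0 ≤ poisson a y := by
  unfold poisson; positivity

lemma continuous_poisson {a : ℝ} (ha : 0 < a) : Continuous (poisson a) :=
  continuous_const.div (by fun_prop) fun y => (sq_add_sq_pos ha y).ne'

lemma continuous_conjPoisson {a : ℝ} (ha : 0 < a) : Continuous (conjPoisson a) :=
  continuous_id.div (by fun_prop) fun y => (sq_add_sq_pos ha y).ne'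

lemma poisson_eq {a : ℝ} (ha : 0 < a) (y : ℝ) :
    poisson a y = a⁻¹ * (1 + (y * a⁻¹) ^ 2)⁻¹ := by
  unfold poisson
  field_simp

lemma integrable_poisson {a : ℝ} (ha : 0 < a) : Integrable (poisson a) := by
  have h := (integrable_inv_one_add_sq.comp_mul_right' (inv_ne_zero ha.ne')).const_mul a⁻¹
  exact h.congr (Eventually.of_forall fun y => (poisson_eq ha y).symm)

lemma integral_poisson {a : ℝ} (ha : 0 < a) : ∫ y, poisson a y = Real.pi := by
  simp_rw [poisson_eq ha]
  rw [integral_const_mul, Measure.integral_comp_mul_right (fun y : ℝ => (1 + y ^ 2)⁻¹),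
    integral_univ_inv_one_add_sq]
  simp [abs_of_pos ha, ha.ne']

lemma lintegral_poisson {a : ℝ} (ha : 0 < a) :
    ∫⁻ y, ENNReal.ofReal (poisson a y) = ENNReal.ofReal Real.pi := by
  rw [← ofReal_integral_eq_lintegral_ofReal (integrable_poisson ha)
    (Eventually.of_forall (poisson_nonneg ha)), integral_poisson ha]

lemma integrable_exp_neg_abs {a : ℝ} (ha : 0 < a) :
    Integrable fun ξ : ℝ => (Real.exp (-(2 * Real.pi * a * |ξ|)) : ℂ) := by
  have hc : 0 < 2 * Real.pi * a := by have := Real.pi_pos; positivity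
  refine Integrable.ofReal ?_
  have h1 : IntegrableOn (fun ξ : ℝ => Real.exp (-(2 * Real.pi * a * |ξ|))) (Set.Ioi 0) := by
    refine (exp_neg_integrableOn_Ioi 0 hc).congr_fun (fun ξ hξ => ?_) measurableSet_Ioi
    have : 0 < ξ := hξ
    simp only [abs_of_pos this]
    ring_nf
  have h2 : IntegrableOn (fun ξ : ℝ => Real.exp (-(2 * Real.pi * a * |ξ|))) (Set.Iic 0) := by
    refine (integrableOn_exp_mul_Iic hc 0).congr_fun (fun ξ hξ => ?_) measurableSet_Iic
    have : ξ ≤ 0 := hξ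
    simp only [abs_of_nonpos this]
    ring_nf
  rw [← integrableOn_univ, ← Set.Iic_union_Ioi (a := (0 : ℝ))]
  exact h2.union h1

/-- The Fourier transform of the Poisson kernel, by Fourier inversion. -/
lemma integral_exp_mul_poisson {a : ℝ} (ha : 0 < a) (ξ : ℝ) :
    ∫ y : ℝ, Complex.exp (((-(2 * Real.pi * (y * ξ)) : ℝ) : ℂ) * Complex.I)
        * ((Real.pi : ℂ)⁻¹ * poisson a y)
      = (Real.exp (-(2 * Real.pi * a * |ξ|)) : ℂ) := by
  set E : ℝ → ℂ := fun ξ => (Real.exp (-(2 * Real.pi * a * |ξ|)) : ℂ) with hE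
  have hinv : 𝓕⁻ E = fun y => (Real.pi : ℂ)⁻¹ * poisson a y := by
    ext y
    rw [Real.fourierInv_eq', ← integral_exp_neg_abs ha y]
    refine integral_congr_ae (Eventually.of_forall fun ξ => ?_)
    simp [hE, smul_eq_mul]
  have hint : Integrable fun y => (Real.pi : ℂ)⁻¹ * (poisson a y : ℂ) :=
    (integrable_poisson ha).ofReal.const_mul _
  have hfour : Integrable (𝓕 E) := by
    have h : 𝓕 E = fun y => 𝓕⁻ E (-y) := by
      ext y; rw [Real.fourierInv_eq_fourier_neg, neg_neg]
    rw [h, hinv]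
    exact hint.comp_neg
  have h := congrFun (Continuous.fourier_fourierInv_eq (f := E) (by fun_prop)
    (integrable_exp_neg_abs ha) hfour) ξ
  rw [hinv, Real.fourier_real_eq_integral_exp_smul] at h
  refine Eq.trans ?_ h
  refine integral_congr_ae (Eventually.of_forall fun y => ?_)
  simp only [smul_eq_mul]
  congr 3
  push_cast
  ring

/-- The truncated kernel `1 / r` differs from a difference of conjugate Poisson kernels by at most
a sum of Poisson kernels: `conjPoisson c` is close to `1 / r` for `|r| ≥ c` and small for
`|r| ≤ c`. -/
lemma abs_truncated_kernel_sub_le {a b : ℝ} (ha : 0 < a) (hab : a ≤ b) (r : ℝ) :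
    |Set.indicator {r : ℝ | a ≤ |r| ∧ |r| ≤ b} (fun r => r⁻¹) r
        - (conjPoisson a r - conjPoisson b r)| ≤ poisson a r + poisson b r := by
  have hb : 0 < b := ha.trans_le hab
  have hQ : ∀ c : ℝ, 0 < c → |r| ≤ c → |conjPoisson c r| ≤ poisson c r := by
    intro c hc h
    have := sq_add_sq_pos hc r
    rw [conjPoisson, poisson, abs_div, abs_of_pos this]
    gcongr
  have hT : ∀ c : ℝ, 0 < c → c ≤ |r| → |r⁻¹ - conjPoisson c r| ≤ poisson c r := by
    intro c hc h
    have h1 := sq_add_sq_pos hc r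
    have hr : r ≠ 0 := by rintro rfl; simp at h; linarith
    have e : r⁻¹ - conjPoisson c r = c ^ 2 / (r * (c ^ 2 + r ^ 2)) := by
      unfold conjPoisson; field_simp; ring
    rw [e, poisson, abs_div, abs_mul, abs_of_pos h1, abs_of_nonneg (sq_nonneg c),
      div_le_div_iff₀ (by positivity) h1]
    have : c ^ 2 ≤ c * |r| := by nlinarith
    nlinarith
  by_cases h1 : a ≤ |r|
  · by_cases h2 : |r| ≤ b
    · rw [Set.indicator_of_mem (show r ∈ {r : ℝ | a ≤ |r| ∧ |r| ≤ b} from ⟨h1, h2⟩)]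
      calc |r⁻¹ - (conjPoisson a r - conjPoisson b r)|
          = |(r⁻¹ - conjPoisson a r) + conjPoisson b r| := by congr 1; ring
        _ ≤ _ := (abs_add_le _ _).trans (add_le_add (hT a ha h1) (hQ b hb h2))
    · rw [Set.indicator_of_notMem (show r ∉ {r : ℝ | a ≤ |r| ∧ |r| ≤ b} from fun h => h2 h.2)]
      calc |0 - (conjPoisson a r - conjPoisson b r)|
          = |(r⁻¹ - conjPoisson a r) - (r⁻¹ - conjPoisson b r)| := by congr 1; ring
        _ ≤ _ := (abs_sub _ _).trans (add_le_add (hT a ha h1) (hT b hb (not_le.1 h2).le))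
  · rw [Set.indicator_of_notMem (show r ∉ {r : ℝ | a ≤ |r| ∧ |r| ≤ b} from fun h => h1 h.1)]
    have h3 : |r| ≤ a := (not_le.1 h1).le
    calc |0 - (conjPoisson a r - conjPoisson b r)|
        = |conjPoisson b r - conjPoisson a r| := by congr 1; ring
      _ ≤ |conjPoisson b r| + |conjPoisson a r| := abs_sub _ _
      _ ≤ _ := by rw [add_comm]; exact add_le_add (hQ a ha h3) (hQ b hb (h3.trans hab))

/-! ### The Hilbert transform -/

section Hilbert

variable {X : Type*} [NormedAddCommGroup X] [NormedSpace ℂ X]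

lemma norm_exp_two_pi_mul_I (u : ℝ) :
    ‖Complex.exp (((2 * Real.pi * u : ℝ) : ℂ) * Complex.I)‖ = 1 :=
  Complex.norm_exp_ofReal_mul_I _

lemma integral_integral_swap_of_norm_le_one {φ : ℝ × ℝ → ℂ} (hφ : Continuous φ)
    (hφ1 : ∀ p, ‖φ p‖ ≤ 1) {k : ℝ → ℂ} (hk : Integrable k) {F : ℝ → X} (hF : Integrable F) :
    ∫ y, ∫ ξ, φ (y, ξ) • k y • F ξ = ∫ ξ, ∫ y, φ (y, ξ) • k y • F ξ := by
  refine integral_integral_swap (f := fun y ξ => φ (y, ξ) • k y • F ξ) ?_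
  refine Integrable.mono' (hk.norm.mul_prod hF.norm)
    (hφ.aestronglyMeasurable.smul (hk.1.comp_fst.smul hF.1.comp_snd))
    (Eventually.of_forall fun p => ?_)
  simp only [Function.uncurry, norm_smul]
  exact mul_le_of_le_one_left (by positivity) (hφ1 _)

/-- The function `-i sgn(ξ) f̂(ξ)`, written with the multiplier at the argument `2π ξ` because of
the normalization of Mathlib's Fourier transform. -/
def signFourier (f : ℝ → X) (ξ : ℝ) : X :=
  (-Complex.I * ((Real.sign (2 * Real.pi * ξ) : ℝ) : ℂ)) • 𝓕 f ξ

lemma measurable_sign : Measurable fun ξ : ℝ => Real.sign (2 * Real.pi * ξ) := by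
  unfold Real.sign
  refine Measurable.ite (measurableSet_lt (by fun_prop) (by fun_prop)) measurable_const
    (Measurable.ite (measurableSet_lt (by fun_prop) (by fun_prop)) measurable_const
      measurable_const)

lemma norm_sign_le (u : ℝ) : ‖(-Complex.I * ((Real.sign u : ℝ) : ℂ))‖ ≤ 1 := by
  rw [norm_mul, norm_neg, Complex.norm_I, one_mul, Complex.norm_real]
  rcases Real.sign_apply_eq u with h | h | h <;> simp [h]

lemma aestronglyMeasurable_sign :
    AEStronglyMeasurable (fun ξ : ℝ => -Complex.I * ((Real.sign (2 * Real.pi * ξ) : ℝ) : ℂ)) :=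
  (measurable_const.mul (Complex.measurable_ofReal.comp measurable_sign)).aestronglyMeasurable

lemma integrable_signFourier (f : 𝓢(ℝ, X)) : Integrable (signFourier (f : ℝ → X)) := by
  have h : Integrable (𝓕 (f : ℝ → X)) := by
    rw [← SchwartzMap.fourier_coe]; exact SchwartzMap.integrable _
  refine Integrable.mono' h.norm (aestronglyMeasurable_sign.smul h.1)
    (Eventually.of_forall fun ξ => ?_)
  rw [signFourier, norm_smul]
  exact mul_le_of_le_one_left (norm_nonneg _) (norm_sign_le _)

/-- The Hilbert transform of a Schwartz function, as the Fourier multiplier `-i sgn`. -/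
def hilbert (f : 𝓢(ℝ, X)) : ℝ → X := 𝓕⁻ (signFourier (f : ℝ → X))

lemma hilbert_apply (f : 𝓢(ℝ, X)) (x : ℝ) :
    hilbert f x = ∫ ξ, Complex.exp (((2 * Real.pi * (x * ξ) : ℝ) : ℂ) * Complex.I)
      • signFourier (f : ℝ → X) ξ := by
  rw [hilbert, Real.fourierInv_eq']
  rfl

lemma continuous_hilbert (f : 𝓢(ℝ, X)) : Continuous (hilbert f) := by
  have h : hilbert f = fun x => ∫ ξ, Complex.exp (((2 * Real.pi * (x * ξ) : ℝ) : ℂ) * Complex.I)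
      • signFourier (f : ℝ → X) ξ := funext (hilbert_apply f)
  rw [h]
  refine continuous_of_dominated (bound := fun ξ => ‖signFourier (f : ℝ → X) ξ‖) (fun x => ?_)
    (fun x => Eventually.of_forall fun ξ => ?_) (integrable_signFourier f).norm
    (Eventually.of_forall fun ξ => ?_)
  · exact Continuous.aestronglyMeasurable (by fun_prop) |>.smul (integrable_signFourier f).1
  · rw [norm_smul, norm_exp_two_pi_mul_I, one_mul]
  · exact Continuous.smul (by fun_prop) continuous_const

/-- The Poisson integral of the Hilbert transform of `f` is the conjugate Poisson integral of `f`: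
on the Fourier side both are multiplication by `-i sgn(ξ) e^{-2π a |ξ|}`. -/
lemma integral_poisson_smul_hilbert [CompleteSpace X] (f : 𝓢(ℝ, X)) {a : ℝ} (ha : 0 < a) (x : ℝ) :
    ∫ y, (poisson a y : ℂ) • hilbert f (x - y) = ∫ y, (conjPoisson a y : ℂ) • f (x - y) := by
  have hpi : (Real.pi : ℂ) ≠ 0 := by exact_mod_cast Real.pi_ne_zero
  have hF := integrable_signFourier f
  have hk : Integrable fun y => (Real.pi : ℂ)⁻¹ * (poisson a y : ℂ) :=
    (integrable_poisson ha).ofReal.const_mul _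
  have hE := integrable_exp_neg_abs ha
  set e : ℝ → ℂ := fun u => Complex.exp (((2 * Real.pi * u : ℝ) : ℂ) * Complex.I) with he
  have he1 : ∀ u, ‖e u‖ ≤ 1 := fun u => (norm_exp_two_pi_mul_I u).le
  have hec : Continuous e := by fun_prop
  have hadd : ∀ u v, e (u + v) = e u * e v := by
    intro u v
    simp only [he]
    rw [← Complex.exp_add]
    congr 1
    push_cast
    ring
  have hmE : Integrable fun ξ : ℝ => -Complex.I * ((Real.sign (2 * Real.pi * ξ) : ℝ) : ℂ)
      * (Real.exp (-(2 * Real.pi * a * |ξ|)) : ℂ) := by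
    refine Integrable.mono' hE.norm (aestronglyMeasurable_sign.mul hE.1)
      (Eventually.of_forall fun ξ => ?_)
    rw [norm_mul]
    exact mul_le_of_le_one_left (norm_nonneg _) (norm_sign_le _)
  have hφ1 : Continuous fun p : ℝ × ℝ => e ((x - p.1) * p.2) := hec.comp (by fun_prop)
  have hφ2 : Continuous fun p : ℝ × ℝ => e ((x - p.2) * p.1) := hec.comp (by fun_prop)
  refine smul_right_injective X (inv_ne_zero hpi) ?_
  simp only
  calc (Real.pi : ℂ)⁻¹ • ∫ y, (poisson a y : ℂ) • hilbert f (x - y)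
      = ∫ y, ∫ ξ, e ((x - y) * ξ) • ((Real.pi : ℂ)⁻¹ * (poisson a y : ℂ))
          • signFourier (f : ℝ → X) ξ := by
        rw [← integral_smul]
        refine integral_congr_ae (Eventually.of_forall fun y => ?_)
        simp only
        rw [hilbert_apply, smul_smul, ← integral_smul]
        refine integral_congr_ae (Eventually.of_forall fun ξ => ?_)
        exact smul_comm _ _ _
    _ = ∫ ξ, ∫ y, e ((x - y) * ξ) • ((Real.pi : ℂ)⁻¹ * (poisson a y : ℂ))
          • signFourier (f : ℝ → X) ξ :=
        integral_integral_swap_of_norm_le_one hφ1 (fun p => he1 _) hk hF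
    _ = ∫ ξ, (e (x * ξ) * (Real.exp (-(2 * Real.pi * a * |ξ|)) : ℂ))
          • signFourier (f : ℝ → X) ξ := by
        refine integral_congr_ae (Eventually.of_forall fun ξ => ?_)
        simp only
        rw [← integral_exp_mul_poisson ha ξ, ← integral_const_mul, ← integral_smul_const]
        refine integral_congr_ae (Eventually.of_forall fun y => ?_)
        simp only
        rw [smul_smul]
        congr 1
        rw [show (x - y) * ξ = x * ξ + -(y * ξ) by ring, hadd]
        simp only [he, mul_neg]
        rw [mul_assoc]
    _ = ∫ ξ, ∫ v, e ((x - v) * ξ) • (-Complex.I * ((Real.sign (2 * Real.pi * ξ) : ℝ) : ℂ)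
          * (Real.exp (-(2 * Real.pi * a * |ξ|)) : ℂ)) • f v := by
        refine integral_congr_ae (Eventually.of_forall fun ξ => ?_)
        simp only
        rw [signFourier, Real.fourier_real_eq_integral_exp_smul, smul_smul, ← integral_smul]
        refine integral_congr_ae (Eventually.of_forall fun v => ?_)
        simp only
        rw [smul_smul, smul_smul, show (x - v) * ξ = x * ξ + -(v * ξ) by ring, hadd]
        congr 1
        have : Complex.exp (((-2 * Real.pi * v * ξ : ℝ) : ℂ) * Complex.I) = e (-(v * ξ)) := by
          simp only [he]
          congr 3
          ring
        rw [this]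
        ring
    _ = ∫ v, ∫ ξ, e ((x - v) * ξ) • (-Complex.I * ((Real.sign (2 * Real.pi * ξ) : ℝ) : ℂ)
          * (Real.exp (-(2 * Real.pi * a * |ξ|)) : ℂ)) • f v :=
        integral_integral_swap_of_norm_le_one hφ2 (fun p => he1 _) hmE f.integrable
    _ = ∫ v, ((Real.pi : ℂ)⁻¹ * (conjPoisson a (x - v) : ℂ)) • f v := by
        refine integral_congr_ae (Eventually.of_forall fun v => ?_)
        simp only
        rw [← integral_sign_mul_exp_neg_abs ha, ← integral_smul_const]
        refine integral_congr_ae (Eventually.of_forall fun ξ => ?_)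
        simp only [smul_smul, he]
    _ = (Real.pi : ℂ)⁻¹ • ∫ y, (conjPoisson a y : ℂ) • f (x - y) := by
        rw [← integral_smul, ← integral_sub_left_eq_self _ volume x]
        refine integral_congr_ae (Eventually.of_forall fun v => ?_)
        simp only [smul_smul, sub_sub_cancel]

/-- The Hilbert transform truncated to `a ≤ |r| ≤ b`, without the factor `1 / π`. -/
def truncHilbert (a b : ℝ) (f : ℝ → X) (x : ℝ) : X :=
  ∫ r in {r : ℝ | a ≤ |r| ∧ |r| ≤ b}, ((r : ℂ)⁻¹) • f (x - r)

/-- The kernel `1 / r`, restricted to `a ≤ |r| ≤ b`. -/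
def truncKernel (a b : ℝ) : ℝ → ℝ :=
  Set.indicator {r : ℝ | a ≤ |r| ∧ |r| ≤ b} (fun r => r⁻¹)

lemma measurableSet_truncation (a b : ℝ) : MeasurableSet {r : ℝ | a ≤ |r| ∧ |r| ≤ b} := by
  have h : {r : ℝ | a ≤ |r| ∧ |r| ≤ b} = {r | a ≤ |r|} ∩ {r | |r| ≤ b} := by ext; simp
  rw [h]
  exact (isClosed_le continuous_const continuous_abs).measurableSet.inter
    (isClosed_le continuous_abs continuous_const).measurableSet

lemma measurable_truncKernel (a b : ℝ) : Measurable (truncKernel a b) :=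
  measurable_inv.indicator (measurableSet_truncation a b)

lemma truncHilbert_eq (a b : ℝ) (f : ℝ → X) (x : ℝ) :
    truncHilbert a b f x = ∫ r, (truncKernel a b r : ℂ) • f (x - r) := by
  rw [truncHilbert, ← integral_indicator (measurableSet_truncation a b)]
  refine integral_congr_ae (Eventually.of_forall fun r => ?_)
  by_cases h : r ∈ {r : ℝ | a ≤ |r| ∧ |r| ≤ b}
  · simp [truncKernel, Set.indicator_of_mem h]
  · simp [truncKernel, Set.indicator_of_notMem h]

lemma abs_truncKernel_le {a : ℝ} (ha : 0 < a) (b r : ℝ) : |truncKernel a b r| ≤ a⁻¹ := by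
  by_cases h : r ∈ {r : ℝ | a ≤ |r| ∧ |r| ≤ b}
  · rw [truncKernel, Set.indicator_of_mem h, abs_inv]
    exact inv_anti₀ ha h.1
  · rw [truncKernel, Set.indicator_of_notMem h, abs_zero]
    positivity

lemma integrable_truncKernel {a : ℝ} (ha : 0 < a) (b : ℝ) : Integrable (truncKernel a b) := by
  have h : IntegrableOn (truncKernel a b) (Set.Icc (-b) b) :=
    Integrable.of_bound (measurable_truncKernel a b).aestronglyMeasurable a⁻¹
      (Eventually.of_forall (abs_truncKernel_le ha b))
  refine (integrableOn_iff_integrable_of_support_subset fun r hr => ?_).1 h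
  by_contra hn
  refine hr (Set.indicator_of_notMem (fun h => hn ?_) _)
  exact abs_le.1 h.2

lemma abs_conjPoisson_le {a : ℝ} (ha : 0 < a) (r : ℝ) : |conjPoisson a r| ≤ a⁻¹ := by
  have h := sq_add_sq_pos ha r
  rw [conjPoisson, abs_div, abs_of_pos h, div_le_iff₀ h, ← div_eq_inv_mul, le_div_iff₀ ha]
  nlinarith [sq_nonneg (a - |r|), sq_abs r, abs_nonneg r, ha]

lemma enorm_ofReal_complex (r : ℝ) : ‖(r : ℂ)‖ₑ = ‖r‖ₑ := by
  rw [← ofReal_norm, Complex.norm_real, ofReal_norm]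

/-- Pointwise control of the truncated Hilbert transform by Poisson integrals. -/
lemma enorm_truncHilbert_le [CompleteSpace X] (f : 𝓢(ℝ, X)) {a b : ℝ} (ha : 0 < a)
    (hab : a ≤ b) (x : ℝ) :
    ‖truncHilbert a b f x‖ₑ ≤
      (∫⁻ y, (ENNReal.ofReal (poisson a y) + ENNReal.ofReal (poisson b y)) * ‖hilbert f (x - y)‖ₑ)
      + ∫⁻ y, (ENNReal.ofReal (poisson a y) + ENNReal.ofReal (poisson b y)) * ‖f (x - y)‖ₑ := by
  have hb : 0 < b := ha.trans_le hab
  have hfi : Integrable fun r => f (x - r) := f.integrable.comp_sub_left x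
  have hbdd : ∀ {k : ℝ → ℝ} {M : ℝ}, AEStronglyMeasurable k → (∀ r, |k r| ≤ M) →
      Integrable fun r => (k r : ℂ) • f (x - r) := by
    intro k M hk hM
    refine Integrable.mono' (hfi.norm.const_mul M)
      ((Complex.continuous_ofReal.comp_aestronglyMeasurable hk).smul hfi.1)
      (Eventually.of_forall fun r => ?_)
    rw [norm_smul, Complex.norm_real]
    exact mul_le_mul_of_nonneg_right (hM r) (norm_nonneg _)
  have hT := hbdd (measurable_truncKernel a b).aestronglyMeasurable (abs_truncKernel_le ha b)
  have hQ : ∀ c, 0 < c → Integrable fun r => (conjPoisson c r : ℂ) • f (x - r) := fun c hc =>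
    hbdd (continuous_conjPoisson hc).aestronglyMeasurable (abs_conjPoisson_le hc)
  have hdec : truncHilbert a b f x
      = (∫ r, ((truncKernel a b r - (conjPoisson a r - conjPoisson b r) : ℝ) : ℂ) • f (x - r))
        + ((∫ r, (poisson a r : ℂ) • hilbert f (x - r))
          - ∫ r, (poisson b r : ℂ) • hilbert f (x - r)) := by
    rw [integral_poisson_smul_hilbert f ha, integral_poisson_smul_hilbert f hb,
      ← integral_sub (hQ a ha) (hQ b hb), truncHilbert_eq]
    have e : ∀ r, ((truncKernel a b r - (conjPoisson a r - conjPoisson b r) : ℝ) : ℂ) • f (x - r)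
        = (truncKernel a b r : ℂ) • f (x - r)
          - ((conjPoisson a r : ℂ) • f (x - r) - (conjPoisson b r : ℂ) • f (x - r)) := by
      intro r; push_cast; module
    simp_rw [e]
    have h := integral_sub hT ((hQ a ha).sub (hQ b hb))
    simp only [Pi.sub_apply] at h
    rw [h, sub_add_cancel]
  have hP : ∀ c, 0 < c → ‖∫ r, (poisson c r : ℂ) • hilbert f (x - r)‖ₑ
      ≤ ∫⁻ r, ENNReal.ofReal (poisson c r) * ‖hilbert f (x - r)‖ₑ := by
    intro c hc
    refine (enorm_integral_le_lintegral_enorm _).trans (lintegral_mono fun r => ?_)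
    rw [enorm_smul, enorm_ofReal_complex, Real.enorm_of_nonneg (poisson_nonneg hc r)]
  have h1 : ‖∫ r, ((truncKernel a b r - (conjPoisson a r - conjPoisson b r) : ℝ) : ℂ)
      • f (x - r)‖ₑ
      ≤ ∫⁻ y, (ENNReal.ofReal (poisson a y) + ENNReal.ofReal (poisson b y)) * ‖f (x - y)‖ₑ := by
    refine (enorm_integral_le_lintegral_enorm _).trans (lintegral_mono fun r => ?_)
    rw [enorm_smul, enorm_ofReal_complex, ← ENNReal.ofReal_add (poisson_nonneg ha r)
      (poisson_nonneg hb r)]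
    gcongr
    rw [Real.enorm_eq_ofReal_abs]
    exact ENNReal.ofReal_le_ofReal (abs_truncated_kernel_sub_le ha hab r)
  have hm : Measurable fun r => ENNReal.ofReal (poisson a r) * ‖hilbert f (x - r)‖ₑ :=
    (continuous_poisson ha).measurable.ennreal_ofReal.mul
      ((continuous_hilbert f).comp (by fun_prop)).enorm.measurable
  simp_rw [add_mul] at h1 ⊢
  rw [hdec, lintegral_add_left hm]
  refine (enorm_add_le _ _).trans ?_
  rw [add_comm ‖_‖ₑ]
  exact add_le_add ((enorm_sub_le).trans (add_le_add (hP a ha) (hP b hb))) h1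

end Hilbert

/-! ### Uniform bounds for truncated Hilbert transforms -/

lemma eLpNorm_two_le_of_enorm_le_lconvolution {X : Type*} [NormedAddCommGroup X]
    {T F H : ℝ → X} {κ : ℝ → ℝ≥0∞} (hκ : Measurable κ) (hF : Measurable fun x => ‖F x‖ₑ) (hH : Measurable fun x => ‖H x‖ₑ)
    (hT : ∀ x, ‖T x‖ₑ ≤ (∫⁻ y, κ y * ‖H (x - y)‖ₑ) + ∫⁻ y, κ y * ‖F (x - y)‖ₑ) :
    eLpNorm T 2 ≤ (∫⁻ y, κ y) * (eLpNorm H 2 + eLpNorm F 2) := by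
  have hconv : ∀ {G : ℝ → ℝ≥0∞}, Measurable G → Measurable fun x => ∫⁻ y, κ y * G (x - y) := by
    intro G hG
    refine Measurable.lintegral_prod_right' (f := fun p : ℝ × ℝ => κ p.2 * G (p.1 - p.2)) ?_
    exact (hκ.comp measurable_snd).mul (hG.comp (by fun_prop))
  have h1 := eLpNorm_two_lconvolution_le hκ hH
  have h2 := eLpNorm_two_lconvolution_le hκ hF
  rw [eLpNorm_enorm] at h1 h2
  have h0 : eLpNorm T 2 ≤ eLpNorm ((fun x => ∫⁻ y, κ y * ‖H (x - y)‖ₑ)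
      + fun x => ∫⁻ y, κ y * ‖F (x - y)‖ₑ) 2 :=
    eLpNorm_mono_enorm fun x => by rw [enorm_eq_self]; exact hT x
  have h3 := eLpNorm_add_le (hconv hH).aestronglyMeasurable
    (hconv hF).aestronglyMeasurable (one_le_two (α := ℝ≥0∞)) (μ := volume)
  rw [mul_add]
  exact h0.trans (h3.trans (add_le_add h1 h2))

section Hilbert

variable {X : Type*} [NormedAddCommGroup X] [NormedSpace ℂ X]

/-- On a UMD space the truncated Hilbert transforms of Schwartz functions are bounded on `L²`,
uniformly in the truncation. -/
lemma exists_eLpNorm_truncHilbert_le_schwartz [CompleteSpace X] (hX : IsUMD X) :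
    ∃ K : ℝ≥0, ∀ (f : 𝓢(ℝ, X)) (a b : ℝ), 0 < a → a ≤ b →
      eLpNorm (truncHilbert a b (f : ℝ → X)) 2 ≤ K * eLpNorm (f : ℝ → X) 2 := by
  obtain ⟨-, c, hc⟩ := hX
  have hc' : ∀ f : 𝓢(ℝ, X), eLpNorm (hilbert f) 2 ≤ c * eLpNorm (f : ℝ → X) 2 :=
    fun f => hc f
  clear hc
  refine ⟨2 * Real.pi.toNNReal * (c + 1), fun f a b ha hab => ?_⟩
  have hb : 0 < b := ha.trans_le hab
  refine (eLpNorm_two_le_of_enorm_le_lconvolution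
    ((continuous_poisson ha).measurable.ennreal_ofReal.add
      (continuous_poisson hb).measurable.ennreal_ofReal) f.continuous.enorm.measurable
    (continuous_hilbert f).enorm.measurable (enorm_truncHilbert_le f ha hab)).trans ?_
  have hκi : ∫⁻ y, (ENNReal.ofReal (poisson a y) + ENNReal.ofReal (poisson b y))
      = 2 * (Real.pi.toNNReal : ℝ≥0∞) := by
    rw [lintegral_add_left (continuous_poisson ha).measurable.ennreal_ofReal,
      lintegral_poisson ha, lintegral_poisson hb, two_mul]
    rfl
  have e : ∀ N : ℝ≥0∞, ((2 * Real.pi.toNNReal * (c + 1) : ℝ≥0) : ℝ≥0∞) * N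
      = 2 * (Real.pi.toNNReal : ℝ≥0∞) * (c * N + N) := fun N => by
    rw [ENNReal.coe_mul, ENNReal.coe_mul, ENNReal.coe_add, ENNReal.coe_ofNat, ENNReal.coe_one]
    ring
  rw [e]
  exact mul_le_mul' hκi.le (add_le_add (hc' f) le_rfl)

end Hilbert

section Extension

variable {X : Type*} [NormedAddCommGroup X] [NormedSpace ℂ X]

lemma integrable_truncKernel_smul {a : ℝ} (ha : 0 < a) (b : ℝ) {F : ℝ → X} (hF : Integrable F)
    (x : ℝ) : Integrable fun r => (truncKernel a b r : ℂ) • F (x - r) := by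
  have hFi : Integrable fun r => F (x - r) := hF.comp_sub_left x
  refine Integrable.mono' (hFi.norm.const_mul a⁻¹)
    ((Complex.continuous_ofReal.comp_aestronglyMeasurable
      (measurable_truncKernel a b).aestronglyMeasurable).smul hFi.1)
    (Eventually.of_forall fun r => ?_)
  rw [norm_smul, Complex.norm_real]
  exact mul_le_mul_of_nonneg_right (abs_truncKernel_le ha b r) (norm_nonneg _)

lemma stronglyMeasurable_truncHilbert (a b : ℝ) {F : ℝ → X} (hF : StronglyMeasurable F) :
    StronglyMeasurable (truncHilbert a b F) := by
  have h : truncHilbert a b F = fun x => ∫ r, (truncKernel a b r : ℂ) • F (x - r) :=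
    funext (truncHilbert_eq a b F)
  rw [h]
  refine StronglyMeasurable.integral_prod_right'
    (f := fun p : ℝ × ℝ => (truncKernel a b p.2 : ℂ) • F (p.1 - p.2)) ?_
  exact (Complex.measurable_ofReal.comp
    ((measurable_truncKernel a b).comp measurable_snd)).stronglyMeasurable.smul
    (hF.comp_measurable (by fun_prop))

/-- Each truncated Hilbert transform is bounded on `L²`, with a bound that depends on the
truncation. -/
lemma eLpNorm_truncHilbert_le_lintegral (a b : ℝ) {F : ℝ → X} (hF : StronglyMeasurable F) :
    eLpNorm (truncHilbert a b F) 2 ≤ (∫⁻ r, ‖truncKernel a b r‖ₑ) * eLpNorm F 2 := by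
  have h := eLpNorm_two_lconvolution_le (measurable_truncKernel a b).enorm hF.enorm
  rw [eLpNorm_enorm] at h
  refine (eLpNorm_mono_enorm fun x => ?_).trans h
  rw [enorm_eq_self, truncHilbert_eq]
  refine (enorm_integral_le_lintegral_enorm _).trans (lintegral_mono fun r => ?_)
  rw [enorm_smul, enorm_ofReal_complex]

/-- A uniform `L²`-bound for a truncated Hilbert transform on Schwartz functions extends
by density. -/
lemma eLpNorm_truncHilbert_le {a b : ℝ} (ha : 0 < a) {K : ℝ≥0}
    (hK : ∀ f : 𝓢(ℝ, X), eLpNorm (truncHilbert a b (f : ℝ → X)) 2 ≤ K * eLpNorm (f : ℝ → X) 2)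
    {F : ℝ → X} (hFm : StronglyMeasurable F) (hFi : Integrable F) (hF : MemLp F 2) :
    eLpNorm (truncHilbert a b F) 2 ≤ K * eLpNorm F 2 := by
  obtain ⟨κ, hκ⟩ : ∃ κ : ℝ≥0, ∫⁻ r, ‖truncKernel a b r‖ₑ = κ :=
    ⟨_, (ENNReal.coe_toNNReal (integrable_truncKernel ha b).2.ne).symm⟩
  have main : ∀ δ : ℝ≥0, 0 < δ →
      eLpNorm (truncHilbert a b F) 2 ≤ K * eLpNorm F 2 + ((K + κ) * δ : ℝ≥0) := by
    intro δ hδ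
    obtain ⟨g, hg, hg', hle⟩ := hF.exist_eLpNorm_sub_le ENNReal.ofNat_ne_top
      one_le_two (ε := δ) hδ
    rw [ENNReal.ofReal_coe_nnreal] at hle
    have hgc : Continuous g := hg'.continuous
    have hgi : Integrable g := hgc.integrable_of_hasCompactSupport hg
    have hFg : StronglyMeasurable (F - g) := hFm.sub hgc.stronglyMeasurable
    have hT : truncHilbert a b F = truncHilbert a b g + truncHilbert a b (F - g) := by
      funext x
      rw [Pi.add_apply, truncHilbert_eq, truncHilbert_eq, truncHilbert_eq]
      refine Eq.trans ?_ (integral_add (integrable_truncKernel_smul ha b hgi x)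
        (integrable_truncKernel_smul ha b (hFi.sub hgi) x))
      refine integral_congr_ae (Eventually.of_forall fun r => ?_)
      simp [← smul_add]
    have h1 : eLpNorm (truncHilbert a b g) 2 ≤ K * eLpNorm g 2 := hK (hg.toSchwartzMap hg')
    have h2 := eLpNorm_truncHilbert_le_lintegral a b hFg
    rw [hκ] at h2
    have h3 : eLpNorm g 2 ≤ eLpNorm F 2 + δ := by
      have e : g = F - (F - g) := by abel
      have h := eLpNorm_sub_le hFm.aestronglyMeasurable hFg.aestronglyMeasurable
        (one_le_two (α := ℝ≥0∞)) (μ := volume)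
      rw [← e] at h
      exact h.trans (add_le_add le_rfl hle)
    have hm1 : AEStronglyMeasurable (truncHilbert a b g) volume :=
      (stronglyMeasurable_truncHilbert a b hgc.stronglyMeasurable).aestronglyMeasurable
    have hm2 : AEStronglyMeasurable (truncHilbert a b (F - g)) volume :=
      (stronglyMeasurable_truncHilbert a b hFg).aestronglyMeasurable
    have h4 := eLpNorm_add_le hm1 hm2 (one_le_two (α := ℝ≥0∞))
    have h5 := add_le_add (h1.trans (mul_le_mul' le_rfl h3)) (h2.trans (mul_le_mul' le_rfl hle))
    rw [hT]
    refine h4.trans (h5.trans (le_of_eq ?_))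
    rw [ENNReal.coe_mul, ENNReal.coe_add]
    ring
  refine ENNReal.le_of_forall_pos_le_add fun ε hε _ => ?_
  refine (main (ε / (K + κ + 1)) (by positivity)).trans (add_le_add le_rfl ?_)
  rw [ENNReal.coe_le_coe, mul_div_assoc', div_le_iff₀ (by positivity), mul_comm]
  exact mul_le_mul' le_rfl (le_add_of_nonneg_right zero_le_one)

end Extension

end CosineCalculus

namespace CosineFunction

open CosineCalculus

/-! ### Transference to the orbits of a cosine function -/

section Transference

variable {X : Type*} [NormedAddCommGroup X] [NormedSpace ℂ X] [CompleteSpace X]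
  {Cos : CosineFunction X}

lemma continuous_truncated (hCos : Cos.IsBounded) {a b : ℝ} (ha : 0 < a) (hab : a ≤ b) (x : X) :
    Continuous fun s => Cos.truncated a b s x := by
  simp_rw [truncated_eq hCos ha hab]
  exact (continuous_iff_continuousAt.2 fun s =>
    (hasDerivAt_Sin (Cos := Cos) s _).continuousAt).const_smul _

/-- The addition formula for the truncated integrals, from
`2 Cos(w - s) Cos(s ∓ r) = Cos(w ∓ r) + Cos(w - 2s ± r)`. -/
lemma truncated_eq_add {a b : ℝ} (ha : 0 < a) (hab : a ≤ b) (w s : ℝ) (x : X) :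
    Cos.truncated a b w x
      = Cos.truncated a b (w - 2 * s) x + (2 : ℂ) • Cos (w - s) (Cos.truncated a b s x) := by
  have hc := fun v => continuousOn_inv_smul_sub (Cos := Cos) ha hab v x
  have hc2 : ContinuousOn (fun r => (2 : ℂ) • Cos (w - s) (r⁻¹ • (Cos (s - r) x - Cos (s + r) x)))
      (Set.uIcc a b) :=
    ((Cos (w - s)).continuous.comp_continuousOn (hc s)).const_smul _
  simp only [truncated_eq_intervalIntegral ha hab]
  rw [← ContinuousLinearMap.intervalIntegral_comp_comm _ (hc s).intervalIntegrable,
    ← intervalIntegral.integral_smul, ← intervalIntegral.integral_add (hc _).intervalIntegrable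
      hc2.intervalIntegrable]
  refine intervalIntegral.integral_congr fun r _ => ?_
  have h1 := Cos.map_add_add_map_sub (w - s) (s - r) x
  have h2 := Cos.map_add_add_map_sub (w - s) (s + r) x
  rw [show w - s + (s - r) = w - r by ring, show w - s - (s - r) = w - 2 * s + r by ring] at h1
  rw [show w - s + (s + r) = w + r by ring, show w - s - (s + r) = w - 2 * s - r by ring] at h2
  rw [ContinuousLinearMap.map_smul_of_tower, smul_comm (2 : ℂ), map_sub, smul_sub (2 : ℂ), ← h1,
    ← h2]
  module

/-- An `L²`-bound for the truncated Hilbert transform, applied to a piece of an orbit, gives an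
`L¹`-bound for the truncated integrals over intervals of length at most `2b`. -/
lemma integral_norm_truncated_le (hCos : Cos.IsBounded) {M : ℝ} (hM : ∀ t, ‖Cos t‖ ≤ M) {a b : ℝ}
    (ha : 0 < a) (hab : a ≤ b) {K : ℝ≥0}
    (hK : ∀ f : 𝓢(ℝ, X), eLpNorm (truncHilbert a b (f : ℝ → X)) 2 ≤ K * eLpNorm (f : ℝ → X) 2)
    {c d : ℝ} (hcd : c ≤ d) (hd : d ≤ c + 2 * b) (x : X) :
    ∫ r in c..d, ‖Cos.truncated a b r x‖ ≤ K * (M * ‖x‖) * (4 * b) := by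
  have hb : 0 < b := ha.trans_le hab
  have hM0 : 0 ≤ M := (norm_nonneg _).trans (hM 0)
  -- For `r ∈ [c, d]` the truncated integral at `r` sees the orbit only on `[c - b, c + 3b]`.
  set W : Set ℝ := Set.Icc (c - b) (c + 3 * b)
  set F : ℝ → X := W.indicator fun t => Cos t x with hFdef
  have hFm : StronglyMeasurable F :=
    (Cos.strongly_continuous x).stronglyMeasurable.indicator measurableSet_Icc
  have hbd : ∀ t, ‖Cos t x‖ ≤ M * ‖x‖ := fun t => norm_apply_le hM t x
  have hW : volume W = ENNReal.ofReal (4 * b) := by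
    rw [Real.volume_Icc]; congr 1; ring
  have : IsFiniteMeasure (volume.restrict W) := ⟨by
    rw [Measure.restrict_apply_univ, hW]; exact ENNReal.ofReal_lt_top⟩
  have hFi : Integrable F := (integrable_indicator_iff measurableSet_Icc).2
    (Cos.integrable_orbit hCos (volume.restrict W) x)
  have hF : MemLp F 2 := (memLp_indicator_iff_restrict measurableSet_Icc).2
    (MemLp.of_bound (Cos.strongly_continuous x).aestronglyMeasurable _
      (Eventually.of_forall hbd))
  have hF2 : eLpNorm F 2 ≤ ENNReal.ofReal (4 * b) ^ (1 / 2 : ℝ) * ENNReal.ofReal (M * ‖x‖) := by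
    rw [hFdef, eLpNorm_indicator_eq_eLpNorm_restrict measurableSet_Icc]
    refine (eLpNorm_le_of_ae_bound (Eventually.of_forall hbd)).trans ?_
    rw [Measure.restrict_apply_univ, hW]
    simp
  have hmain := eLpNorm_truncHilbert_le ha hK hFm hFi hF
  have hT : ∀ r ∈ Set.Ioc c d, truncHilbert a b F r = Cos.truncated a b r x := by
    intro r hr
    refine setIntegral_congr_fun (measurableSet_truncation a b) fun ρ hρ => ?_
    have := abs_le.1 hρ.2
    simp only [hFdef]
    rw [Set.indicator_of_mem]
    exact ⟨by linarith [hr.1, hr.2], by linarith [hr.1, hr.2]⟩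
  have hTc := continuous_truncated hCos ha hab x
  have h2 : eLpNorm (fun r => Cos.truncated a b r x) 2 (volume.restrict (Set.Ioc c d))
      ≤ eLpNorm (truncHilbert a b F) 2 := by
    rw [← eLpNorm_congr_ae (f := truncHilbert a b F) ((ae_restrict_iff' measurableSet_Ioc).2
      (Eventually.of_forall hT))]
    exact eLpNorm_mono_measure _ Measure.restrict_le_self
  have h1 := eLpNorm_le_eLpNorm_mul_rpow_measure_univ (μ := volume.restrict (Set.Ioc c d))
    (one_le_two (α := ℝ≥0∞)) hTc.aestronglyMeasurable
  rw [Measure.restrict_apply_univ, Real.volume_Ioc] at h1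
  rw [intervalIntegral.integral_of_le hcd, integral_norm_eq_lintegral_enorm
    hTc.aestronglyMeasurable, ← eLpNorm_one_eq_lintegral_enorm]
  refine ENNReal.toReal_le_of_le_ofReal (by positivity) (h1.trans ?_)
  have h3 : ENNReal.ofReal (d - c) ^ (1 / (1 : ℝ≥0∞).toReal - 1 / (2 : ℝ≥0∞).toReal)
      ≤ ENNReal.ofReal (4 * b) ^ (1 / 2 : ℝ) := by
    rw [show (1 / (1 : ℝ≥0∞).toReal - 1 / (2 : ℝ≥0∞).toReal) = (1 / 2 : ℝ) by norm_num]
    exact ENNReal.rpow_le_rpow (ENNReal.ofReal_le_ofReal (by linarith)) (by norm_num)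
  have h4 : ENNReal.ofReal (4 * b) ^ (1 / 2 : ℝ) * ENNReal.ofReal (4 * b) ^ (1 / 2 : ℝ)
      = ENNReal.ofReal (4 * b) := by
    rw [← ENNReal.rpow_add_of_nonneg _ _ (by norm_num) (by norm_num)]
    norm_num
  refine (mul_le_mul' (h2.trans (hmain.trans (mul_le_mul' le_rfl hF2))) h3).trans (le_of_eq ?_)
  rw [ENNReal.ofReal_mul (p := K * (M * ‖x‖)) (by positivity),
    ENNReal.ofReal_mul (p := (K : ℝ)) (by positivity), ENNReal.ofReal_coe_nnreal, mul_assoc _ _ (ENNReal.ofReal (4 * b)),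
    mul_comm _ (ENNReal.ofReal (4 * b)), mul_assoc, mul_right_comm, h4]

/-- Averaging the addition formula over `s ∈ [0, b]` turns the `L¹`-bounds on the orbit into a
uniform bound. -/
lemma norm_truncated_le (hCos : Cos.IsBounded) {M : ℝ} (hM : ∀ t, ‖Cos t‖ ≤ M) {a b : ℝ}
    (ha : 0 < a) (hab : a ≤ b) {K : ℝ≥0}
    (hK : ∀ f : 𝓢(ℝ, X), eLpNorm (truncHilbert a b (f : ℝ → X)) 2 ≤ K * eLpNorm (f : ℝ → X) 2)
    (w : ℝ) (x : X) : ‖Cos.truncated a b w x‖ ≤ (2 + 8 * M) * K * M * ‖x‖ := by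
  have hb : 0 < b := ha.trans_le hab
  have hM0 : 0 ≤ M := (norm_nonneg _).trans (hM 0)
  have hTc : Continuous fun s => ‖Cos.truncated a b s x‖ := (continuous_truncated hCos ha hab x).norm
  have hTc' : Continuous fun s => ‖Cos.truncated a b (w - 2 * s) x‖ := hTc.comp (by fun_prop)
  have hpt : ∀ s ∈ Set.Icc 0 b, ‖Cos.truncated a b w x‖
      ≤ ‖Cos.truncated a b (w - 2 * s) x‖ + 2 * M * ‖Cos.truncated a b s x‖ := by
    intro s _
    rw [truncated_eq_add ha hab w s x]
    refine (norm_add_le _ _).trans (add_le_add le_rfl ?_)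
    rw [norm_smul, Complex.norm_ofNat, mul_assoc]
    exact mul_le_mul_of_nonneg_left (norm_apply_le hM _ _) zero_le_two
  have h := intervalIntegral.integral_mono_on (μ := volume) hb.le intervalIntegrable_const
    ((hTc'.add (hTc.const_mul (2 * M))).intervalIntegrable 0 b) hpt
  simp only [Pi.add_apply] at h
  rw [intervalIntegral.integral_const, intervalIntegral.integral_add
    (hTc'.intervalIntegrable _ _) ((hTc.const_mul _).intervalIntegrable _ _),
    intervalIntegral.integral_const_mul,
    intervalIntegral.integral_comp_sub_mul (fun s => ‖Cos.truncated a b s x‖) two_ne_zero] at h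
  simp only [smul_eq_mul, sub_zero, mul_zero] at h
  have h1 := integral_norm_truncated_le hCos hM ha hab hK (c := w - 2 * b) (d := w)
    (by linarith) (by linarith) x
  have h2 := integral_norm_truncated_le hCos hM ha hab hK (c := 0) (d := b) hb.le (by linarith) x
  refine le_of_mul_le_mul_left (h.trans ?_) hb
  nlinarith [mul_le_mul_of_nonneg_left h2 (mul_nonneg zero_le_two hM0)]

end Transference

/-! ### Density of the domain of the generator -/

section DenseDomain

variable {X : Type*} [NormedAddCommGroup X] [NormedSpace ℂ X] [CompleteSpace X]
  {Cos : CosineFunction X} {A : X →ₗ.[ℂ] X}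

/-- The domain of the generator is dense: `λ² R(λ²) x → x` as `λ → ∞`, where
`λ² R(λ²) x = ∫_0^∞ e^{-t} Cos(t / λ) x dt`. -/
lemma dense_domain (hCos : Cos.IsBounded) (hA : Cos.IsGenerator (-A)) :
    Dense (A.domain : Set X) := by
  intro x
  obtain ⟨M, hM⟩ := id hCos
  refine mem_closure_of_tendsto (b := atTop)
    (f := fun l : ℝ => ∫ t in Set.Ioi (0 : ℝ), Real.exp (-t) • Cos (l⁻¹ * t) x) ?_ ?_
  · have h0 : ∫ t in Set.Ioi (0 : ℝ), Real.exp (-t) • x = x := by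
      rw [integral_smul_const, integral_exp_neg_Ioi_zero, one_smul]
    refine (congrArg (Tendsto _ _) (congrArg 𝓝 h0)).mp ?_
    refine tendsto_integral_filter_of_dominated_convergence
      (fun t => Real.exp (-t) * (M * ‖x‖)) ?_ ?_ ?_ ?_
    · refine Eventually.of_forall fun l => ?_
      exact ((by fun_prop : Continuous fun t : ℝ => Real.exp (-t)).smul
        ((Cos.strongly_continuous x).comp (by fun_prop))).aestronglyMeasurable
    · refine Eventually.of_forall fun l => Eventually.of_forall fun t => ?_
      rw [norm_smul, Real.norm_of_nonneg (Real.exp_pos _).le]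
      exact mul_le_mul_of_nonneg_left (norm_apply_le hM _ _) (Real.exp_pos _).le
    · exact (integrableOn_exp_neg_Ioi 0).mul_const _
    · refine Eventually.of_forall fun t => Tendsto.const_smul ?_ _
      have h1 : Tendsto (fun l : ℝ => l⁻¹ * t) atTop (𝓝 0) := by
        simpa using tendsto_inv_atTop_zero.mul_const t
      have h2 := ((Cos.strongly_continuous x).tendsto 0).comp h1
      simpa [Cos.map_zero, Function.comp_def] using h2
  · filter_upwards [eventually_gt_atTop 0] with l hl
    obtain ⟨R, hR, hRx⟩ := exists_resolvent hCos hA hl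
    have hmem : R ((l ^ 2) • x) ∈ A.domain := (hR.1 _).1
    have h := integral_comp_mul_left_Ioi (fun u => Real.exp (-l * u) • Cos u x) 0 (inv_pos.2 hl)
    rw [mul_zero, inv_inv, ← hRx, smul_smul, ← sq, ← R.map_smul_of_tower] at h
    rw [← h] at hmem
    refine (congrArg (· ∈ A.domain) (integral_congr_ae (Eventually.of_forall fun t => ?_))).mp hmem
    have : -l * (l⁻¹ * t) = -t := by field_simp
    simp only [this]

end DenseDomain

/-! ### The case of a UMD space -/

section UMD

variable {X : Type*} [NormedAddCommGroup X] [NormedSpace ℂ X] [CompleteSpace X]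
  {Cos : CosineFunction X} {A : X →ₗ.[ℂ] X}

/-- On a UMD space the truncated principal value integrals of the orbits are uniformly bounded. -/
lemma exists_norm_truncated_le (hCos : Cos.IsBounded) (hX : IsUMD X) :
    ∃ C : ℝ, 0 ≤ C ∧ ∀ a b : ℝ, 0 < a → a ≤ b → ∀ s x, ‖Cos.truncated a b s x‖ ≤ C * ‖x‖ := by
  obtain ⟨K, hK⟩ := exists_eLpNorm_truncHilbert_le_schwartz hX
  obtain ⟨M, hM⟩ := id hCos
  have hM0 : 0 ≤ M := (norm_nonneg _).trans (hM 0)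
  exact ⟨(2 + 8 * M) * K * M, by positivity, fun a b ha hab s x =>
    norm_truncated_le hCos hM ha hab (fun f => hK f a b ha hab) s x⟩

/-- Uniform boundedness of the truncations carries the principal value representation from the
dense subspace `D(A)` to all of `X`, because `S(s)` is closed. -/
lemma exists_principalValue_of_bound (hCos : Cos.IsBounded) (hA : Cos.IsGenerator (-A)) {C : ℝ}
    (hC : ∀ a b : ℝ, 0 < a → a ≤ b → ∀ s x, ‖Cos.truncated a b s x‖ ≤ C * ‖x‖) (s : ℝ) (x : X) :
    ∃ l : X, HasPrincipalValue (fun r : ℝ => ((r : ℂ)⁻¹) • Cos (s - r) x) l ∧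
      (x, ((Real.pi : ℂ)⁻¹) • l) ∈ (Cos.opS hCos s).graph ∧ ‖l‖ ≤ C * ‖x‖ := by
  have hev : ∀ᶠ p : ℝ × ℝ in 𝓝[>] (0 : ℝ) ×ˢ atTop, 0 < p.1 ∧ p.1 ≤ p.2 := by
    have hfst : Tendsto (fun p : ℝ × ℝ => p.1) (𝓝[>] (0 : ℝ) ×ˢ atTop) (𝓝[>] (0 : ℝ)) :=
      tendsto_fst
    have hsnd : Tendsto (fun p : ℝ × ℝ => p.2) (𝓝[>] (0 : ℝ) ×ˢ atTop) atTop := tendsto_snd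
    filter_upwards [hfst.eventually self_mem_nhdsWithin,
      hfst.eventually (mem_nhdsWithin_of_mem_nhds (Iic_mem_nhds zero_lt_one)),
      hsnd.eventually (eventually_ge_atTop 1)] with p h1 h2 h3
    exact ⟨h1, h2.trans h3⟩
  have hpv : ∀ {y l : X}, HasPrincipalValue (fun r : ℝ => ((r : ℂ)⁻¹) • Cos (s - r) y) l ↔
      Tendsto (fun p : ℝ × ℝ => Cos.truncated p.1 p.2 s y) (𝓝[>] (0 : ℝ) ×ˢ atTop) (𝓝 l) :=
    Iff.rfl
  obtain ⟨u, hu, hux⟩ := mem_closure_iff_seq_limit.1 (dense_domain hCos hA x)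
  choose l hl hg using fun n => exists_principalValue_of_mem_domain hCos hA s (hu n)
  simp only [hpv] at hl
  have hbd : ∀ n (y : X), ∀ᶠ p : ℝ × ℝ in 𝓝[>] (0 : ℝ) ×ˢ atTop,
      ‖Cos.truncated p.1 p.2 s (u n) - Cos.truncated p.1 p.2 s y‖ ≤ C * ‖u n - y‖ := by
    intro n y
    filter_upwards [hev] with p hp
    rw [← truncated_sub hp.1 hp.2]
    exact hC _ _ hp.1 hp.2 _ _
  -- `‖l m - l n‖ ≤ C ‖u m - u n‖` by passing to the limit in the bound for the truncations
  have hcau : CauchySeq l := by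
    have hu' := hux.cauchySeq
    rw [Metric.cauchySeq_iff] at hu' ⊢
    intro ε hε
    obtain ⟨N, hN⟩ := hu' (ε / (|C| + 1)) (by positivity)
    refine ⟨N, fun m hm n hn => ?_⟩
    have h1 : ‖l m - l n‖ ≤ C * ‖u m - u n‖ :=
      le_of_tendsto ((hl m).sub (hl n)).norm (hbd m (u n))
    have h2 := hN m hm n hn
    rw [dist_eq_norm, lt_div_iff₀ (by positivity)] at h2
    rw [dist_eq_norm]
    refine h1.trans_lt (lt_of_le_of_lt ?_ h2)
    rw [mul_comm]
    exact mul_le_mul_of_nonneg_left ((le_abs_self C).trans (by linarith)) (norm_nonneg _)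
  obtain ⟨L, hL⟩ := cauchySeq_tendsto_of_complete hcau
  have hlim : Tendsto (fun p : ℝ × ℝ => Cos.truncated p.1 p.2 s x)
      (𝓝[>] (0 : ℝ) ×ˢ atTop) (𝓝 L) := by
    have h0 : Tendsto (fun n => C * ‖u n - x‖ + ‖l n - L‖) atTop (𝓝 0) := by
      have h1 := (tendsto_iff_norm_sub_tendsto_zero.1 hux).const_mul C
      simpa using h1.add (tendsto_iff_norm_sub_tendsto_zero.1 hL)
    rw [Metric.tendsto_nhds]
    intro ε hε
    obtain ⟨n, hn⟩ := (h0.eventually (gt_mem_nhds (half_pos hε))).exists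
    filter_upwards [Metric.tendsto_nhds.1 (hl n) _ (half_pos hε), hbd n x] with p h1 h2
    rw [dist_eq_norm] at h1 ⊢
    rw [norm_sub_rev] at h2
    have e : Cos.truncated p.1 p.2 s x - L
        = (Cos.truncated p.1 p.2 s x - Cos.truncated p.1 p.2 s (u n))
          + ((Cos.truncated p.1 p.2 s (u n) - l n) + (l n - L)) := by abel
    rw [e]
    refine (norm_add_le _ _).trans_lt ?_
    linarith [norm_add_le (Cos.truncated p.1 p.2 s (u n) - l n) (l n - L)]
  refine ⟨L, hpv.2 hlim, ?_, le_of_tendsto hlim.norm ?_⟩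
  · exact (isClosed_graph_calculus (isRegularizer_sin hCos hA s)).mem_of_tendsto
      (hux.prodMk_nhds (hL.const_smul _)) (Eventually.of_forall hg)
  · filter_upwards [hev] with p hp using hC _ _ hp.1 hp.2 _ _

lemma exists_norm_opS_le (hCos : Cos.IsBounded) (hA : Cos.IsGenerator (-A)) (hX : IsUMD X) :
    ∃ K : ℝ, ∀ s : ℝ, (Cos.opS hCos s).domain = ⊤ ∧
      ∀ x : (Cos.opS hCos s).domain, ‖Cos.opS hCos s x‖ ≤ K * ‖(x : X)‖ := by
  obtain ⟨C, -, hC⟩ := exists_norm_truncated_le hCos hX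
  refine ⟨Real.pi⁻¹ * C, fun s => ⟨?_, fun x => ?_⟩⟩
  · rw [eq_top_iff]
    intro x _
    obtain ⟨l, -, hg, -⟩ := exists_principalValue_of_bound hCos hA hC s x
    exact LinearPMap.mem_domain_of_mem_graph hg
  · obtain ⟨l, -, hg, hle⟩ := exists_principalValue_of_bound hCos hA hC s x
    obtain ⟨y, hy1, hy2⟩ := (LinearPMap.mem_graph_iff _).1 hg
    have hxy : y = x := Subtype.ext hy1
    rw [hxy] at hy2
    simp only at hy2
    rw [hy2, norm_smul, norm_inv, Complex.norm_real, Real.norm_of_nonneg Real.pi_pos.le, mul_assoc]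
    exact mul_le_mul_of_nonneg_left hle (inv_nonneg.2 Real.pi_pos.le)

end UMD

end CosineFunction

end

theorem theorem5p1 {X : Type*} [NormedAddCommGroup X] [NormedSpace ℂ X] [CompleteSpace X]
    (Cos : CosineFunction X) (hCos : Cos.IsBounded)
    (A : X →ₗ.[ℂ] X) (hA : Cos.IsGenerator (-A)) :
    -- `S(s) = B Sin(s)` as unbounded operators (equality of graphs)
    (∀ (s : ℝ) (x y : X),
      (x, y) ∈ (Cos.opS hCos s).graph ↔ (Cos.Sin s x, y) ∈ (Cos.opB hCos).graph) ∧
    -- the representation formula on the domain of `A`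
    (∀ (s : ℝ), ∀ x ∈ A.domain, ∃ l : X,
      CosineCalculus.HasPrincipalValue (fun r : ℝ => ((r : ℂ)⁻¹) • Cos (s - r) x) l ∧
      (x, ((Real.pi : ℂ)⁻¹) • l) ∈ (Cos.opS hCos s).graph) ∧
    -- the case of a UMD space
    (CosineCalculus.IsUMD X →
      (∃ K : ℝ, ∀ s : ℝ, (Cos.opS hCos s).domain = ⊤ ∧
        ∀ x : (Cos.opS hCos s).domain, ‖Cos.opS hCos s x‖ ≤ K * ‖(x : X)‖) ∧
      (∀ (s : ℝ) (x : X), ∃ l : X,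
        CosineCalculus.HasPrincipalValue (fun r : ℝ => ((r : ℂ)⁻¹) • Cos (s - r) x) l ∧
        (x, ((Real.pi : ℂ)⁻¹) • l) ∈ (Cos.opS hCos s).graph)) := by
  refine ⟨fun s x y => CosineFunction.mem_graph_opS_iff hCos hA s x y, fun s x hx =>
    CosineFunction.exists_principalValue_of_mem_domain hCos hA s hx, fun hX =>
    ⟨CosineFunction.exists_norm_opS_le hCos hA hX, fun s x => ?_⟩⟩
  obtain ⟨C, -, hC⟩ := Cos.exists_norm_truncated_le hCos hX
  obtain ⟨l, hl, hg, -⟩ := CosineFunction.exists_principalValue_of_bound hCos hA hC s x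
  exact ⟨l, hl, hg⟩
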